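/- Let $k\ge 0$ be an integer. A configuration is a sequence ${\bf a}=(a_i)_{i\in\mathbf Z}$ of non-negative integers, finitely many of them non-zero. For $0\le l\le k$ let $C^{(k,l)}$ be the set of configurations such that for all $i$ \[ a_i+a_{i+1}+a_{i+2}\le k,\qquad S_i({\bf a}):=a_i+a_{i+1}\le l,\qquad L_i({\bf a}):=a_{i-1}+2a_i+2a_{i+1}+a_{i+2}\le k+l . \] For integers $a,b\ge 0$ with $a+b\le l$, let $C^{(k,l)}_{a,b}$ be the set of ${\bf a}\in C^{(k,l)}$ with $a_i=0$ for $i<0$, $a_0=a$ and $a_1=b$. A rigged partition $(\lambda,\rho)$ consists of a partition $\lambda_1\ge\dots\ge\lambda_n\ge1$ ($n\ge 0$) and integers $\rho_1,\dots,\rho_n$ with $\rho_i\ge\rho_{i+1}$ whenever $\lambda_i=\lambda_{i+1}$. Let $R^{(l)}$ be the set of rigged partitions all of whose parts are at most $l$. For non-negative integers ${\bf r}=(r_1,\dots,r_l)$ put \[ R^{(l)}({\bf r})=\{(\lambda,\rho)\in R^{(l)}:\ \rho_i\ge r_{\lambda_i}\ \text{for all } i\}, \] and for $J_1,\dots,J_n\subset\{1,\dots,l\}$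 put \[ R^{(l)}({\bf r})_{J_1,\dots,J_n}=R^{(l)}({\bf r})\setminus\bigcup_{m=1}^n R^{(l)}({\bf r}(J_m)), \] where ${\bf r}(J)_i=r_i+1$ for $i\in J$ and ${\bf r}(J)_i=r_i$ otherwise. The map $\iota:C^{(k,l)}\to R^{(l)}$ is defined as follows. Put $A_{p,p'}=2\min(p,p')+\max(p+p'-k,0)$. The zero configuration goes to the empty rigged partition. If ${\bf a}\ne{\bf 0}$, let $p$ be the least integer with ${\bf a}\in C^{(k,p)}$. The right move $M_+$ takes the largest index $i$ with $S_i=p$ or $L_i=k+p$ (the highest position), lowers the $i$-th entry by $1$ and raises the $(i+1)$-st entry by $1$. Apply $M_+$ repeatedly, say $t$ times, until one reaches a configuration ${\bf b}$ with a free particle: at its highest position $i$ one has $b_i+b_{i+1}=p$, $b_i\ne0$, and $b_j=0$ for all $j\ge i+2$. Let $d=ib_i+(i+1)b_{i+1}$, let $\overline{\bf a}$ be obtained from ${\bf b}$ by replacing $b_i$ and $b_{i+1}$ by $0$, and let $(\overline\lambda,\overline\rho)=\iota(\overline{\bf a})$. Then $\iota({\bf a})=(\lambda,\rho)$ is obtained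 from $(\overline\lambda,\overline\rho)$ by putting in front of it the part $\lambda_1=p$ with rigging $\rho_1=d-t-\sum_{j\ge2}A_{p,\lambda_j}$. (The values $d-t$ and $\overline{\bf a}$ do not depend on the choice of $t$.) **Theorem.** Let $a,b,l\ge0$ be integers with $a+b\le l$. For $k\ge l$ the image $[a,b]_l=\iota(C^{(k,l)}_{a,b})$ is independent of $k$, and it is given by \[ [a,b]_l= \begin{cases} R^{(l)}({\bf r}_{a,b})_{[a,a+b],\,[a+b,l]}&\text{if } a\ne0,\\ R^{(l)}({\bf r}_{a,b})_{[b,l]}&\text{if } a=0 \text{ and } b\ne0,\\ R^{(l)}({\bf r}_{a,b})&\text{if } a=0 \text{ and } b=0, \end{cases} \] where $[l_1,l_2]=\{l_1,l_1+1,\dots,l_2\}$ and \[ {\bf r}_{a,b}=(\underbrace{0,\ldots,0}_a,\underbrace{1,2,\ldots,b}_b,\underbrace{b+2,b+4,\ldots,2l-2a-b}_{l-a-b}). \] -/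

import Mathlib

namespace RiggedConf

/-- A configuration: a two-sided sequence of non-negative integers. -/
abbrev Config := ℤ → ℕ

/-- `S[j, a] = a_j + a_{j+1}`. -/
def S (a : Config) (j : ℤ) : ℕ := a j + a (j + 1)

/-- `L[j, a] = a_{j-1} + 2 a_j + 2 a_{j+1} + a_{j+2}`. -/
def L (a : Config) (j : ℤ) : ℕ := a (j - 1) + 2 * a j + 2 * a (j + 1) + a (j + 2)

/-- The set `C^{(k)}` of finite `(k,3)`-admissible configurations. -/
def C (k : ℕ) : Set Config :=
  {a | {i : ℤ | a i ≠ 0}.Finite ∧ ∀ i : ℤ, a i + a (i + 1) + a (i + 2) ≤ k}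

/-- The set `C^{(k,l)}` of configurations in `C^{(k)}` of maximal weight at most `l`
(meant for `l ≤ k`). -/
def CMax (k l : ℕ) : Set Config :=
  {a | a ∈ C k ∧ (∀ i : ℤ, S a i ≤ l) ∧ ∀ i : ℤ, L a i ≤ k + l}

/-- The set `C^{(k,l)}_{pos}` of positively supported configurations in `C^{(k,l)}`. -/
def CPos (k l : ℕ) : Set Config :=
  {a | a ∈ CMax k l ∧ ∀ i : ℤ, i < 0 → a i = 0}

/-- The set `C^{(k,l)}_{a,b}` of those `c ∈ C^{(k,l)}_{pos}` with `c_0 = a` and `c_1 = b`. -/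
def CInit (k l a b : ℕ) : Set Config :=
  {c | c ∈ CPos k l ∧ c 0 = a ∧ c 1 = b}

/-- The maximal weight of `a ∈ C^{(k)}`: the least `l` with `a ∈ C^{(k,l)}`
(one always has `C^{(k)} = C^{(k,k)}`). -/
noncomputable def weight (k : ℕ) (a : Config) : ℕ := sInf {l : ℕ | a ∈ CMax k l}

/-- The highest position of a particle of weight `l`: the largest `i` with
`S[i, a] = l` or `L[i, a] = k + l`. -/
noncomputable def highest (k l : ℕ) (a : Config) : ℤ :=
  sSup {i : ℤ | S a i = l ∨ L a i = k + l}

/-- The right move `M_+`: one unit is moved from the highest position `i` of a weight `l`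
particle to `i + 1`. (For a configuration of maximal weight exactly `l ≥ 1` one has `a_i > 0`,
so the subtraction is a true one.) -/
noncomputable def rightMove (k l : ℕ) (a : Config) : Config := fun j =>
  if j = highest k l a + 1 then a j + 1
  else if j = highest k l a then a j - 1
  else a j

/-- `a` contains a free particle of weight `l` at the highest position. -/
def IsFree (k l : ℕ) (a : Config) : Prop :=
  S a (highest k l a) = l ∧ a (highest k l a) ≠ 0 ∧
    ∀ j : ℤ, highest k l a + 2 ≤ j → a j = 0

/-- The number of right moves after which the first weight `l` particle becomes free.
(From then on it stays free, and neither `s = d - t` nor the remaining configuration depends on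
how many further right moves are made.) -/
noncomputable def freeTime (k l : ℕ) (a : Config) : ℕ :=
  sInf {t : ℕ | IsFree k l ((rightMove k l)^[t] a)}

/-- `A_{l,l'} = 2 min(l,l') + (l + l' - k)_+`; truncated subtraction is the positive part. -/
def A (k l l' : ℕ) : ℕ := 2 * min l l' + (l + l' - k)

/-- The part of `a` strictly to the left of `i`. -/
def cutLeft (i : ℤ) (a : Config) : Config := fun j => if j < i then a j else 0

/-- The length `|a| = ∑ a_i`. -/
noncomputable def length (a : Config) : ℕ := ∑ᶠ i : ℤ, a i

open Classical in
/-- Particle content and rigging, as the list of pairs `(λ_i, ρ_i)`, by recursion on the number of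
particles still to be removed, for which the first argument is an upper bound. Each step moves the
highest particle of maximal weight `l` to the right until it is free, at position `i` with energy
`d = i b_i + (i+1) b_{i+1}` after `t` moves, removes it, and puts
`λ_1 = l`, `ρ_1 = (d - t) - ∑_{j ≥ 2} A_{l, λ_j}`. -/
noncomputable def iotaAux (k : ℕ) : ℕ → Config → List (ℕ × ℤ)
  | 0, _ => []
  | n + 1, a =>
    if a = 0 then [] else
      let l := weight k a
      let t := freeTime k l a
      let b := (rightMove k l)^[t] a
      let i := highest k l b
      let d : ℤ := i * (b i : ℤ) + (i + 1) * (b (i + 1) : ℤ)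
      let rest := iotaAux k n (cutLeft i b)
      (l, d - (t : ℤ) - (rest.map fun p => (A k l p.1 : ℤ)).sum) :: rest

/-- The map `ι` sending a configuration in `C^{(k)}` to the rigged partition given by its particle
content and rigging. (Every particle has weight at least one, so there are at most `|a|` of
them.) -/
noncomputable def iota (k : ℕ) (a : Config) : List (ℕ × ℤ) := iotaAux k (length a) a

/-- The set `R^{(l)}` of rigged partitions `((λ_1, ρ_1), …, (λ_n, ρ_n))` with parts at most `l`:
`l ≥ λ_1 ≥ ⋯ ≥ λ_n > 0` and `ρ_i ≥ ρ_{i+1}` whenever `λ_i = λ_{i+1}`. -/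
def R (l : ℕ) : Set (List (ℕ × ℤ)) :=
  {x | (∀ p ∈ x, 0 < p.1 ∧ p.1 ≤ l) ∧
    x.IsChain fun p q => q.1 ≤ p.1 ∧ (p.1 = q.1 → q.2 ≤ p.2)}

/-- The set `R^{(l)}(r)` of rigged partitions in `R^{(l)}` with `ρ_i ≥ r_{λ_i}` for all `i`.
Only the values `r_1, …, r_l` matter. -/
def RBound (l : ℕ) (r : ℕ → ℕ) : Set (List (ℕ × ℤ)) :=
  {x | x ∈ R l ∧ ∀ p ∈ x, (r p.1 : ℤ) ≤ p.2}

/-- `r(J)`: the sequence `r` raised by one on `J`. -/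
def bump (r : ℕ → ℕ) (J : Finset ℕ) : ℕ → ℕ := fun i => if i ∈ J then r i + 1 else r i

/-- `R^{(l)}(r)_{J_1,…,J_n}`, i.e. `R^{(l)}(r)` minus the union of the `R^{(l)}(r(J_m))`. -/
def RMinus (l : ℕ) (r : ℕ → ℕ) (Js : List (Finset ℕ)) : Set (List (ℕ × ℤ)) :=
  RBound l r \ ⋃ J ∈ Js, RBound l (bump r J)

/-- `r_{a,b} = (0, …, 0, 1, …, b, b + 2, b + 4, …, 2l - 2a - b)` with blocks of lengths
`a`, `b`, `l - a - b`, as a function of the index `i = 1, …, l`. -/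
def rInit (a b : ℕ) : ℕ → ℕ := fun i =>
  if i ≤ a then 0 else if i ≤ a + b then i - a else b + 2 * (i - a - b)

end RiggedConf

set_option linter.unusedSimpArgs false

namespace RiggedConf

/-! Let b have maximal weight at most p, and let a particle of weight p travel through b to the
right. The part of b behind the particle is unchanged; the part ahead of it sits two places further
right, up to a correction e, the carry, solving the right-to-left recursion `IsCarry` with q = k -
p. The mixed configuration, with x extra units at position h, is described by `IsInsert`. A right
move lowers x by one and, when x is used up, h advances. So the particle carries an integer level(h)
- x, where level grows from m to m + 1 by p - S_m - e_m, and each right move raises this integer by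
exactly one (`IsMove.isInsert`).

The total carry is conserved by right moves of particles of weight p' ≤ p and drops by (p + p' -
k)_+ when a free one is removed (`Extract.exists_carry`). Hence the sum of the A_{p,λ_j} is the
total of S_j + e_j (`sum_A_iota`), and the rigging is precisely level(h) - x
(`Extract.iota_eq_level`). Levels are monotone. Therefore riggings of equal parts are ordered
(`iota_mem_R`), and every element of R^(l) occurs, because any integer ρ satisfies level(h - 1) ≤ ρ
< level(h) for some h (`exists_iota_eq`).

At the left end of a support contained in [m, ∞) there is no carry and the first levels are
explicit. This gives a_m = max(0, (m+1)λ_i - ρ_i) and 2a_m + a_{m+1} = max(0, (m+2)λ_i - ρ_i), the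
maxima running over all i (`iota_bounds`). For m = 0 these formulas describe the image without k
(`image_CInit`). The inequalities say ρ_i ≥ r_{a,b}(λ_i), since r_{a,b}(i) = max(0, i - a, 2i - 2a -
b); attainment of the two maxima accounts for the removed sets. -/

variable {k p q : ℕ} {a b c c' e : Config} {h : ℤ} {x : ℕ} {s : ℤ}

/-! ### Carry sequences: existence, uniqueness, bounds. -/

/-- The carry sequence `e` which governs how a particle of weight `k - q` passes through `a`. -/
structure IsCarry (k q : ℕ) (a e : Config) : Prop where
  eq : ∀ m : ℤ, e m = max (S a (m - 2) + S a (m - 1) - k) (S a (m - 1) - q - e (m + 1))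
  right : ∃ N : ℤ, ∀ m, N ≤ m → e m = 0

theorem descend {P : ℤ → Prop} (N : ℤ) (hN : ∀ m, N ≤ m → P m)
    (h : ∀ m, (∀ n, m < n → P n) → P m) (m : ℤ) : P m := by
  have key : ∀ n : ℕ, ∀ m, N - m ≤ n → P m := by
    intro n
    induction n with
    | zero => intro m hm; exact hN m (by push_cast at hm; omega)
    | succ n ih =>
      intro m hm
      refine h m fun r hr => ih r ?_
      push_cast at hm
      omega
  exact key (N - m).toNat m (by omega)

theorem exists_bounds (h : {i : ℤ | a i ≠ 0}.Finite) :
    ∃ M N : ℤ, M ≤ N ∧ (∀ i, i < M → a i = 0) ∧ ∀ i, N ≤ i → a i = 0 := by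
  obtain ⟨M, hM⟩ := h.bddBelow
  obtain ⟨N, hN⟩ := h.bddAbove
  refine ⟨min M N, N + 1, by omega, fun i hi => ?_, fun i hi => ?_⟩
  · by_contra h0
    have := hM (show i ∈ {i : ℤ | a i ≠ 0} from h0)
    omega
  · by_contra h0
    have := hN (show i ∈ {i : ℤ | a i ≠ 0} from h0)
    omega

theorem finite_of_bounds {M N : ℤ} (hM : ∀ i, i < M → a i = 0) (hN : ∀ i, N ≤ i → a i = 0) :
    {i : ℤ | a i ≠ 0}.Finite := by
  refine (Set.finite_Ico M N).subset fun i hi => ?_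
  refine ⟨?_, ?_⟩
  · by_contra h
    exact hi (hM i (by omega))
  · by_contra h
    exact hi (hN i (by omega))

/-- Recursion for the carry with the number of steps to go as fuel. -/
def carryAux (k q : ℕ) (a : Config) : ℕ → ℤ → ℕ
  | 0, _ => 0
  | n + 1, m => max (S a (m - 2) + S a (m - 1) - k) (S a (m - 1) - q - carryAux k q a n (m + 1))

theorem exists_isCarry (k q : ℕ) (h : {i : ℤ | a i ≠ 0}.Finite) : ∃ e, IsCarry k q a e := by
  obtain ⟨M, N, -, -, hN⟩ := exists_bounds h
  refine ⟨fun m => carryAux k q a (N + 3 - m).toNat m, fun m => ?_, N + 3, fun m hm => ?_⟩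
  · by_cases hm : N + 3 ≤ m
    · have h1 : (N + 3 - m).toNat = 0 := by omega
      have h2 : (N + 3 - (m + 1)).toNat = 0 := by omega
      rw [h1, h2]
      simp only [carryAux, S]
      rw [hN (m - 2) (by omega), hN (m - 2 + 1) (by omega), hN (m - 1) (by omega),
        hN (m - 1 + 1) (by omega)]
      simp
    · have h1 : (N + 3 - m).toNat = (N + 3 - (m + 1)).toNat + 1 := by omega
      rw [h1, carryAux]
  · have h1 : (N + 3 - m).toNat = 0 := by omega
    simp only [h1, carryAux]

theorem IsCarry.unique_below {a' e' : Config} (he : IsCarry k q a e) (he' : IsCarry k q a' e')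
    {i : ℤ} (ha : ∀ j, j < i → a j = a' j) (hi : e i = e' i) : ∀ j, j ≤ i → e j = e' j := by
  intro j
  refine descend (P := fun j => j ≤ i → e j = e' j) i (fun m hm hmi => ?_) (fun m ih hm => ?_) j
  · rw [show m = i by omega, hi]
  · rcases eq_or_lt_of_le hm with rfl | hlt
    · exact hi
    · rw [he.eq, he'.eq, ih (m + 1) (by omega) (by omega)]
      simp only [S]
      rw [ha (m - 2) (by omega), ha (m - 2 + 1) (by omega), ha (m - 1) (by omega),
        ha (m - 1 + 1) (by omega)]

theorem IsCarry.unique {e' : Config} (he : IsCarry k q a e) (he' : IsCarry k q a e') :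
    e = e' := by
  obtain ⟨N, hN⟩ := he.right
  obtain ⟨N', hN'⟩ := he'.right
  funext j
  exact he.unique_below he' (i := max j (max N N')) (fun _ _ => rfl)
    (by rw [hN _ (by omega), hN' _ (by omega)]) j (by omega)

/-- The triple condition controls the first term of the recursion. For the second, the bound two
places further right yields a(m+1) ≤ q + e(m+2), so the induction descends in steps of two. The
bound makes the subtraction in `passed` a true one. -/
theorem IsCarry.le_apply (he : IsCarry k q a e)
    (hT : ∀ i : ℤ, a i + a (i + 1) + a (i + 2) ≤ k) (m : ℤ) : e (m + 1) ≤ a m := by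
  obtain ⟨N, hN⟩ := he.right
  refine descend (P := fun m => e (m + 1) ≤ a m) N (fun m hm => ?_) (fun m ih => ?_) m
  · rw [hN _ (by omega)]; omega
  · have h1 := he.eq (m + 1)
    have h2 := he.eq (m + 2)
    have h3 := ih (m + 2) (by omega)
    have h4 := hT (m - 1)
    simp only [S, sub_eq_add_neg, add_assoc, Int.reduceNeg, Int.reduceAdd, Int.add_zero]
      at h1 h2 h3 h4 ⊢
    omega

/-- If e m is the first term of its recursion, use the bound on L at m - 1; if it is the second,
insert e(m+1) ≥ S(m-1) + S(m) - k. This is what leaves room for the particle and makes `level`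
monotone. -/
theorem IsCarry.S_add_le (he : IsCarry k (k - p) a e) (hp : p ≤ k) (hS : ∀ i, S a i ≤ p)
    (hL : ∀ i, L a i ≤ k + p) (m : ℤ) : S a m + e m ≤ p := by
  have h1 := he.eq m
  have h2 := he.eq (m + 1)
  have h3 := hL (m - 1)
  have h4 := hS m
  have h5 := hS (m - 1)
  have h6 := hS (m - 2)
  simp only [S, L, sub_eq_add_neg, add_assoc, Int.reduceNeg, Int.reduceAdd, Int.add_zero]
    at h1 h2 h3 h4 h5 h6 ⊢
  omega

theorem IsCarry.eq_zero_right (he : IsCarry k q a e)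
    (hT : ∀ i : ℤ, a i + a (i + 1) + a (i + 2) ≤ k) {N : ℤ} (hN : ∀ i, N ≤ i → a i = 0) (m : ℤ)
    (hm : N < m) : e m = 0 := by
  have h := he.le_apply hT (m - 1)
  rw [hN _ (by omega), sub_add_cancel] at h
  omega

theorem IsCarry.eq_zero_left (he : IsCarry k q a e)
    (hT : ∀ i : ℤ, a i + a (i + 1) + a (i + 2) ≤ k) {M : ℤ} (hM : ∀ i, i < M → a i = 0) (m : ℤ)
    (hm : m ≤ M) : e m = 0 := by
  have h := he.le_apply hT (m - 1)
  rw [hM _ (by omega), sub_add_cancel] at h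
  omega

theorem IsCarry.finite (he : IsCarry k q a e) (ha : a ∈ C k) : {i : ℤ | e i ≠ 0}.Finite := by
  obtain ⟨M, N, -, hM, hN⟩ := exists_bounds ha.1
  exact finite_of_bounds (M := M) (N := N + 1) (fun i hi => he.eq_zero_left ha.2 hM i (by omega))
    (fun i hi => he.eq_zero_right ha.2 hN i (by omega))

/-! ### Insertion of a particle of weight p. -/

/-- The part of `a` seen by a particle that has already passed it. -/
def passed (a e : Config) : Config := fun j => a (j - 2) + e (j - 2) - e (j - 1)

/-- The configuration `a` with a particle of weight `p` at position `h`, with excess `x` there. -/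
def insertAt (p : ℕ) (a e : Config) (h : ℤ) (x : ℕ) : Config := fun j =>
  if j < h then a j
  else if j = h then a j + x
  else if j = h + 1 then passed a e j + (p - (S a (h - 1) + e (h - 1)) - x)
  else passed a e j

theorem insertAt_lt {j : ℤ} (hj : j < h) : insertAt p a e h x j = a j := if_pos hj

theorem insertAt_self : insertAt p a e h x h = a h + x := by simp [insertAt]

theorem insertAt_succ :
    insertAt p a e h x (h + 1) = passed a e (h + 1) + (p - (S a (h - 1) + e (h - 1)) - x) := by
  simp [insertAt]

theorem insertAt_gt {j : ℤ} (hj : h + 1 < j) : insertAt p a e h x j = passed a e j := by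
  rw [insertAt, if_neg (by omega), if_neg (by omega), if_neg (by omega)]

theorem IsCarry.passed_add (he : IsCarry k q a e)
    (hT : ∀ i : ℤ, a i + a (i + 1) + a (i + 2) ≤ k) (j : ℤ) :
    passed a e j + e (j - 1) = a (j - 2) + e (j - 2) := by
  have h1 := he.le_apply hT (j - 2)
  rw [show j - 2 + 1 = j - 1 by ring] at h1
  simp only [passed]
  omega

theorem L_eq (a : Config) (i : ℤ) : L a i = S a (i - 1) + S a i + S a (i + 1) := by
  simp only [S, L, sub_eq_add_neg, add_assoc, Int.reduceNeg, Int.reduceAdd, Int.add_zero]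
  omega

theorem IsCarry.S_add_S_le (he : IsCarry k q a e) (m : ℤ) :
    S a (m - 2) + S a (m - 1) ≤ k + e m := by
  have := he.eq m
  omega

theorem IsCarry.S_le (he : IsCarry k q a e) (m : ℤ) : S a (m - 1) ≤ q + e m + e (m + 1) := by
  have := he.eq m
  omega

theorem IsCarry.apply_le (he : IsCarry k q a e)
    (hT : ∀ i : ℤ, a i + a (i + 1) + a (i + 2) ≤ k) (m : ℤ) : a m ≤ q + e (m + 1) := by
  have h1 := he.S_le (m + 1)
  have h2 := he.le_apply hT (m + 1)
  simp only [S, sub_eq_add_neg, add_assoc, Int.reduceNeg, Int.reduceAdd, Int.add_zero] at *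
  omega

/-- The data of a particle of weight `p` inserted at position `h`. -/
structure IsInsert (k p : ℕ) (a e : Config) (h : ℤ) (x : ℕ) (c : Config) : Prop where
  le : x + S a (h - 1) + e (h - 1) ≤ p
  lt : ∀ j, j < h → c j = a j
  self : c h = a h + x
  S_self : S c h + e h = p
  gt : ∀ j, h + 1 < j → c j + e (j - 1) = a (j - 2) + e (j - 2)

theorem isInsert_insertAt (he : IsCarry k q a e)
    (hT : ∀ i : ℤ, a i + a (i + 1) + a (i + 2) ≤ k) (hx : x + S a (h - 1) + e (h - 1) ≤ p) :
    IsInsert k p a e h x (insertAt p a e h x) := by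
  refine ⟨hx, fun j => insertAt_lt, insertAt_self, ?_, fun j hj => ?_⟩
  · rw [S, insertAt_self, insertAt_succ]
    have h1 := he.passed_add hT (h + 1)
    simp only [S, sub_eq_add_neg, add_assoc, Int.reduceNeg, Int.reduceAdd, Int.add_zero] at *
    omega
  · rw [insertAt_gt hj]
    exact he.passed_add hT j

namespace IsInsert

theorem S_lt (hc : IsInsert k p a e h x c) {j : ℤ} (hj : j < h - 1) : S c j = S a j := by
  rw [S, S, hc.lt _ (by omega), hc.lt _ (by omega)]

theorem S_pred (hc : IsInsert k p a e h x c) : S c (h - 1) = S a (h - 1) + x := by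
  rw [S, S, hc.lt _ (by omega), sub_add_cancel, hc.self, add_assoc]

theorem apply_succ (hc : IsInsert k p a e h x c) : c (h + 1) + a h + x + e h = p := by
  have h1 := hc.S_self
  have h2 := hc.self
  simp only [S] at *
  omega

theorem S_succ (hc : IsInsert k p a e h x c) : S c (h + 1) + e (h + 1) + x = p := by
  have h1 := hc.apply_succ
  have h2 := hc.gt (h + 2) (by omega)
  simp only [S, sub_eq_add_neg, add_assoc, Int.reduceNeg, Int.reduceAdd, Int.add_zero] at *
  omega

theorem S_gt (hc : IsInsert k p a e h x c) {j : ℤ} (hj : h + 1 < j) :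
    S c j + e j = S a (j - 2) + e (j - 2) := by
  have h1 := hc.gt j hj
  have h2 := hc.gt (j + 1) (by omega)
  simp only [S, sub_eq_add_neg, add_assoc, Int.reduceNeg, Int.reduceAdd, Int.add_zero] at *
  omega

theorem S_le (hc : IsInsert k p a e h x c) (he : IsCarry k (k - p) a e) (hp : p ≤ k)
    (ha : a ∈ CMax k p) (i : ℤ) : S c i ≤ p := by
  obtain ⟨⟨-, hT⟩, hS, hL⟩ := ha
  rcases lt_or_ge i (h - 1) with h1 | h1
  · rw [hc.S_lt h1]; exact hS i
  rcases eq_or_lt_of_le h1 with rfl | h2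
  · have := hc.S_pred
    have := hc.le
    omega
  rcases eq_or_lt_of_le (show h ≤ i by omega) with rfl | h3
  · have := hc.S_self
    omega
  rcases eq_or_lt_of_le (show h + 1 ≤ i by omega) with rfl | h4
  · have := hc.S_succ
    omega
  have := hc.S_gt h4
  have := he.S_add_le hp hS hL (i - 2)
  omega

/-- Far to the right of h the three S-sums telescope to two terms of the form S + e, each at most p,
plus S a (i-1) - e i - e (i+1), which the recursion bounds by k - p. The cases near h are boundary
versions of this. -/
theorem L_le (hc : IsInsert k p a e h x c) (he : IsCarry k (k - p) a e) (hp : p ≤ k)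
    (ha : a ∈ CMax k p) (i : ℤ) : L c i ≤ k + p := by
  obtain ⟨⟨-, hT⟩, hS, hL⟩ := ha
  have s0 := hc.S_pred
  have s1 := hc.S_self
  have s2 := hc.S_succ
  have s3 := hc.le
  rw [L_eq]
  rcases lt_or_ge i (h - 2) with h1 | h1
  · rw [hc.S_lt (by omega), hc.S_lt (by omega), hc.S_lt (by omega), ← L_eq]; exact hL i
  rcases eq_or_lt_of_le h1 with rfl | h2
  · have h4 := hc.S_lt (show h - 3 < h - 1 by omega)
    have h5 := hc.S_lt (show h - 2 < h - 1 by omega)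
    have h6 := he.S_add_S_le (h - 1)
    simp only [sub_eq_add_neg, add_assoc, Int.reduceNeg, Int.reduceAdd, Int.add_zero] at *
    omega
  rcases eq_or_lt_of_le (show h - 1 ≤ i by omega) with rfl | h2
  · have h5 := hc.S_lt (show h - 2 < h - 1 by omega)
    have h6 := he.S_le (h - 1)
    simp only [sub_eq_add_neg, add_assoc, Int.reduceNeg, Int.reduceAdd, Int.add_zero] at *
    omega
  rcases eq_or_lt_of_le (show h ≤ i by omega) with rfl | h3
  · have h6 := he.S_le h
    simp only [sub_eq_add_neg, add_assoc, Int.reduceNeg, Int.reduceAdd, Int.add_zero] at *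
    omega
  rcases eq_or_lt_of_le (show h + 1 ≤ i by omega) with rfl | h4
  · have h6 := he.S_le (h + 1)
    have h7 := hc.S_gt (show h + 1 < h + 2 by omega)
    simp only [sub_eq_add_neg, add_assoc, Int.reduceNeg, Int.reduceAdd, Int.add_zero] at *
    omega
  rcases eq_or_lt_of_le (show h + 2 ≤ i by omega) with rfl | h5
  · have h6 := he.S_le (h + 2)
    have h7 := hc.S_gt (show h + 1 < h + 2 by omega)
    have h8 := hc.S_gt (show h + 1 < h + 3 by omega)
    have d0 := he.S_add_le hp hS hL h
    simp only [sub_eq_add_neg, add_assoc, Int.reduceNeg, Int.reduceAdd, Int.add_zero] at *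
    omega
  · have h6 := he.S_le i
    have h7 := hc.S_gt (show h + 1 < i - 1 by omega)
    have h8 := hc.S_gt (show h + 1 < i by omega)
    have h9 := hc.S_gt (show h + 1 < i + 1 by omega)
    have d0 := he.S_add_le hp hS hL (i - 3)
    have d1 := he.S_add_le hp hS hL (i - 2)
    simp only [sub_eq_add_neg, add_assoc, Int.reduceNeg, Int.reduceAdd, Int.add_zero] at *
    omega

theorem triple_le (hc : IsInsert k p a e h x c) (he : IsCarry k (k - p) a e) (hp : p ≤ k)
    (ha : a ∈ CMax k p) (i : ℤ) : c i + c (i + 1) + c (i + 2) ≤ k := by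
  obtain ⟨⟨-, hT⟩, hS, hL⟩ := ha
  have s0 := hc.self
  have s1 := hc.apply_succ
  have s2 := hc.S_succ
  have s3 := hc.le
  rcases lt_or_ge i (h - 2) with h1 | h1
  · rw [hc.lt _ (by omega), hc.lt _ (by omega), hc.lt _ (by omega)]; exact hT i
  rcases eq_or_lt_of_le h1 with rfl | h2
  · have h4 := hc.lt _ (show h - 2 < h by omega)
    have h5 := hc.lt _ (show h - 1 < h by omega)
    have h6 := he.apply_le hT (h - 2)
    simp only [S, sub_eq_add_neg, add_assoc, Int.reduceNeg, Int.reduceAdd, Int.add_zero] at *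
    omega
  rcases eq_or_lt_of_le (show h - 1 ≤ i by omega) with rfl | h2
  · have h5 := hc.lt _ (show h - 1 < h by omega)
    have h6 := he.apply_le hT (h - 1)
    simp only [S, sub_eq_add_neg, add_assoc, Int.reduceNeg, Int.reduceAdd, Int.add_zero] at *
    omega
  rcases eq_or_lt_of_le (show h ≤ i by omega) with rfl | h3
  · have h6 := he.apply_le hT h
    simp only [S, sub_eq_add_neg, add_assoc, Int.reduceNeg, Int.reduceAdd, Int.add_zero] at *
    omega
  rcases eq_or_lt_of_le (show h + 1 ≤ i by omega) with rfl | h4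
  · have h6 := he.apply_le hT (h + 1)
    have h7 := hc.gt _ (show h + 1 < h + 3 by omega)
    simp only [S, sub_eq_add_neg, add_assoc, Int.reduceNeg, Int.reduceAdd, Int.add_zero] at *
    omega
  · have h6 := he.apply_le hT i
    have h7 := hc.gt i (by omega)
    have h8 := hc.gt (i + 1) (by omega)
    have h9 := hc.gt (i + 2) (by omega)
    have d0 := he.S_add_le hp hS hL (i - 2)
    simp only [S, sub_eq_add_neg, add_assoc, Int.reduceNeg, Int.reduceAdd, Int.add_zero] at *
    omega

theorem mem_CMax (hc : IsInsert k p a e h x c) (he : IsCarry k (k - p) a e) (hp : p ≤ k)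
    (ha : a ∈ CMax k p) : c ∈ CMax k p := by
  refine ⟨⟨?_, hc.triple_le he hp ha⟩, hc.S_le he hp ha, hc.L_le he hp ha⟩
  obtain ⟨M, N, -, hM, hN⟩ := exists_bounds ha.1.1
  refine finite_of_bounds (M := min M h) (N := max (N + 3) (h + 2)) (fun i hi => ?_)
    fun i hi => ?_
  · rw [hc.lt _ (by omega), hM _ (by omega)]
  · have h1 := hc.gt i (by omega)
    rw [hN _ (by omega), he.eq_zero_right ha.1.2 hN (i - 2) (by omega)] at h1
    omega

/-- A position at which the weight `p` is attained. -/
theorem tight (hc : IsInsert k p a e h x c) (he : IsCarry k (k - p) a e) (hp : p ≤ k)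
    (hx : 0 < x) : S c h = p ∨ L c h = k + p := by
  have s0 := hc.S_pred
  have s1 := hc.S_self
  have s2 := hc.S_succ
  have s3 := hc.le
  have e1 := he.eq h
  have e2 := he.eq (h - 1)
  rw [L_eq]
  simp only [sub_eq_add_neg, add_assoc, Int.reduceNeg, Int.reduceAdd, Int.add_zero] at *
  omega

/-- With `tight`, this makes h the top of c. The strict inequality at h + 1 is where a positive
excess is needed: S c (h+1) = p - e (h+1) - x. -/
theorem not_tight (hc : IsInsert k p a e h x c) (he : IsCarry k (k - p) a e) (hp : p ≤ k)
    (ha : a ∈ CMax k p) (hx : 0 < x) (hlt : ∀ j, h ≤ j → S a j < p ∧ L a j < k + p) (i : ℤ)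
    (hi : h < i) : S c i < p ∧ L c i < k + p := by
  obtain ⟨⟨-, hT⟩, hS, hL⟩ := ha
  have s2 := hc.S_succ
  have s3 := hc.le
  constructor
  · rcases eq_or_lt_of_le (show h + 1 ≤ i by omega) with rfl | h4
    · omega
    have s4 := hc.S_gt h4
    have l0 := hlt (i - 2) (by omega)
    have d0 := he.S_add_le hp hS hL (i - 2)
    have e0 := he.eq (i - 2)
    have e1 := he.S_add_S_le (i - 1)
    have e2 := he.S_le (i - 1)
    have e3 := he.S_le (i - 3)
    rcases eq_or_lt_of_le (show h + 2 ≤ i by omega) with rfl | h5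
    · simp only [sub_eq_add_neg, add_assoc, Int.reduceNeg, Int.reduceAdd, Int.add_zero] at *
      omega
    have l1 := hlt (i - 3) (by omega)
    rw [L_eq] at l1
    simp only [sub_eq_add_neg, add_assoc, Int.reduceNeg, Int.reduceAdd, Int.add_zero] at *
    omega
  · have s1 := hc.S_self
    rw [L_eq]
    rcases eq_or_lt_of_le (show h + 1 ≤ i by omega) with rfl | h4
    · have h6 := he.S_le (h + 1)
      have h7 := hc.S_gt (show h + 1 < h + 2 by omega)
      simp only [sub_eq_add_neg, add_assoc, Int.reduceNeg, Int.reduceAdd, Int.add_zero] at *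
      omega
    rcases eq_or_lt_of_le (show h + 2 ≤ i by omega) with rfl | h5
    · have h6 := he.S_le (h + 2)
      have h7 := hc.S_gt (show h + 1 < h + 2 by omega)
      have h8 := hc.S_gt (show h + 1 < h + 3 by omega)
      have d0 := he.S_add_le hp hS hL h
      simp only [sub_eq_add_neg, add_assoc, Int.reduceNeg, Int.reduceAdd, Int.add_zero] at *
      omega
    have h6 := he.S_le i
    have h7 := hc.S_gt (show h + 1 < i - 1 by omega)
    have h8 := hc.S_gt (show h + 1 < i by omega)
    have h9 := hc.S_gt (show h + 1 < i + 1 by omega)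
    have d0 := he.S_add_le hp hS hL (i - 3)
    have d1 := he.S_add_le hp hS hL (i - 2)
    have l1 := hlt (i - 3) (by omega)
    have l2 := hlt (i - 2) (by omega)
    have e0 := he.eq (i - 2)
    have e1 := he.eq (i - 3)
    have e2 := he.S_le (i - 1)
    have e3 := he.S_add_S_le (i - 1)
    have e4 := he.S_le (i - 4)
    rw [L_eq] at l1 l2
    rcases eq_or_lt_of_le (show h + 3 ≤ i by omega) with rfl | h6
    · simp only [sub_eq_add_neg, add_assoc, Int.reduceNeg, Int.reduceAdd, Int.add_zero] at *
      omega
    have l3 := hlt (i - 4) (by omega)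
    rw [L_eq] at l3
    simp only [sub_eq_add_neg, add_assoc, Int.reduceNeg, Int.reduceAdd, Int.add_zero] at *
    omega

/-- A particle of the same weight p that is still ahead is pushed right but survives: the tight
place g of a reappears in c at g + 2, g + 3 or g + 4. Hence a new highest particle must lie strictly
beyond the old one. -/
theorem exists_tight (hc : IsInsert k p a e h x c) (he : IsCarry k (k - p) a e) (hp : p ≤ k)
    (ha : a ∈ CMax k p) {g : ℤ} (hg : h ≤ g) (hga : S a g = p ∨ L a g = k + p)
    (hlt : ∀ j, g < j → S a j < p ∧ L a j < k + p) :
    ∃ i, h < i ∧ (S c i = p ∨ L c i = k + p) := by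
  obtain ⟨⟨-, hT⟩, hS, hL⟩ := ha
  by_contra hcon
  push Not at hcon
  have n1 := (hcon (g + 2) (by omega)).1
  have n2 := hcon (g + 3) (by omega)
  have n3 := (hcon (g + 4) (by omega)).2
  have s1 := hc.S_gt (show h + 1 < g + 2 by omega)
  have s2 := hc.S_gt (show h + 1 < g + 3 by omega)
  have s3 := hc.S_gt (show h + 1 < g + 4 by omega)
  have s4 := hc.S_gt (show h + 1 < g + 5 by omega)
  have l1 := (hlt (g + 1) (by omega)).2
  have l2 := (hlt (g + 2) (by omega)).2
  have b0 := he.S_le g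
  have b1 := he.S_add_S_le (g + 1)
  have b1' := he.S_le (g + 1)
  have b2 := he.S_add_S_le (g + 2)
  have b2' := he.S_le (g + 2)
  have b3 := he.S_add_S_le (g + 3)
  have b3' := he.S_le (g + 3)
  have d0 := he.S_add_le hp hS hL g
  have d1 := he.S_add_le hp hS hL (g + 1)
  have d2 := he.S_add_le hp hS hL (g + 2)
  have c2 : e (g + 2) = 0 ∨ e (g + 2) + k = S a g + S a (g + 1) ∨
      e (g + 2) + (k - p) + e (g + 3) = S a (g + 1) := by
    have := he.eq (g + 2)
    rw [show g + 2 - 2 = g by ring, show g + 2 - 1 = g + 1 by ring,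
      show g + 2 + 1 = g + 3 by ring] at this
    omega
  have c3 : e (g + 3) = 0 ∨ e (g + 3) + k = S a (g + 1) + S a (g + 2) ∨
      e (g + 3) + (k - p) + e (g + 4) = S a (g + 2) := by
    have := he.eq (g + 3)
    rw [show g + 3 - 2 = g + 1 by ring, show g + 3 - 1 = g + 2 by ring,
      show g + 3 + 1 = g + 4 by ring] at this
    omega
  have c4 : e (g + 4) = 0 ∨ e (g + 4) + k = S a (g + 2) + S a (g + 3) ∨
      e (g + 4) + (k - p) + e (g + 5) = S a (g + 3) := by
    have := he.eq (g + 4)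
    rw [show g + 4 - 2 = g + 2 by ring, show g + 4 - 1 = g + 3 by ring,
      show g + 4 + 1 = g + 5 by ring] at this
    omega
  rw [L_eq] at hga l1 l2 n2 n3
  obtain ⟨q, rfl⟩ := Nat.exists_eq_add_of_le hp
  rw [Nat.add_sub_cancel_left] at *
  clear hcon hlt hT hS hL he hc
  simp only [sub_eq_add_neg, add_assoc, Int.reduceNeg, Int.reduceAdd, Int.add_zero] at *
  rcases hga with hga | hga
  · rcases c2 with c2 | c2 | c2
    · omega
    · rcases c3 with c3 | c3 | c3 <;> omega
    · omega
  · rcases c2 with c2 | c2 | c2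
    · omega
    · rcases c3 with c3 | c3 | c3
      · omega
      · rcases c4 with c4 | c4 | c4 <;> omega
      · omega
    · rcases c3 with c3 | c3 | c3
      · omega
      · rcases c4 with c4 | c4 | c4 <;> omega
      · omega

end IsInsert

/-! ### Right moves and their effect on insertions. -/

/-- `h` is the highest position of a particle of weight `p` in `a`. -/
structure IsTop (k p : ℕ) (a : Config) (h : ℤ) : Prop where
  tight : S a h = p ∨ L a h = k + p
  not_tight : ∀ j, h < j → ¬ (S a j = p ∨ L a j = k + p)

theorem IsTop.lt (hh : IsTop k p a h) (ha : a ∈ CMax k p) (j : ℤ) (hj : h < j) :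
    S a j < p ∧ L a j < k + p := by
  have h1 := hh.not_tight j hj
  have h2 := ha.2.1 j
  have h3 := ha.2.2 j
  omega

/-- With a zero entry at h, tightness at h would force S = p at h + 1, by the triple condition at h
- 1 in the case of L. So the truncated subtraction in `rightMove` is harmless. -/
theorem IsTop.apply_pos (hh : IsTop k p a h) (ha : a ∈ CMax k p) : 0 < a h := by
  have h1 := hh.lt ha (h + 1) (by omega)
  have h2 := hh.tight
  have h3 := ha.1.2 (h - 1)
  simp only [S, L, sub_eq_add_neg, add_assoc, Int.reduceNeg, Int.reduceAdd, Int.add_zero] at *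
  omega

/-- `c'` is obtained from `c` by moving one unit from `h` to `h + 1`. -/
structure IsMove (h : ℤ) (c c' : Config) : Prop where
  self : c' h + 1 = c h
  succ : c' (h + 1) = c (h + 1) + 1
  of_ne : ∀ j, j ≠ h → j ≠ h + 1 → c' j = c j

namespace IsMove

theorem S_pred (hc : IsMove h c c') : S c' (h - 1) + 1 = S c (h - 1) := by
  have h1 := hc.self
  have h2 := hc.of_ne (h - 1) (by omega) (by omega)
  simp only [S, sub_add_cancel]
  omega

theorem S_self (hc : IsMove h c c') : S c' h = S c h := by
  have h1 := hc.self
  have h2 := hc.succ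
  simp only [S]
  omega

theorem S_succ (hc : IsMove h c c') : S c' (h + 1) = S c (h + 1) + 1 := by
  have h1 := hc.succ
  have h2 := hc.of_ne (h + 1 + 1) (by omega) (by omega)
  simp only [S]
  omega

theorem S_of_ne (hc : IsMove h c c') {j : ℤ} (h1 : j ≠ h - 1) (h2 : j ≠ h + 1) :
    S c' j = S c j := by
  by_cases hj : j = h
  · rw [hj, hc.S_self]
  · rw [S, S, hc.of_ne j hj h2, hc.of_ne (j + 1) (by omega) (by omega)]

theorem L_self (hc : IsMove h c c') : L c' h = L c h := by
  have h1 := hc.S_pred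
  have h2 := hc.S_self
  have h3 := hc.S_succ
  rw [L_eq, L_eq]
  omega

theorem tight_iff (hc : IsMove h c c') :
    (S c' h = p ∨ L c' h = k + p) ↔ (S c h = p ∨ L c h = k + p) := by
  rw [hc.S_self, hc.L_self]

theorem L_of_gt (hc : IsMove h c c') {j : ℤ} (hj : h + 2 < j) : L c' j = L c j := by
  rw [L_eq, L_eq, hc.S_of_ne (by omega) (by omega), hc.S_of_ne (by omega) (by omega),
    hc.S_of_ne (by omega) (by omega)]

theorem mem_CMax (hc : IsMove h c c') (hh : IsTop k p c h) (ha : c ∈ CMax k p) :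
    c' ∈ CMax k p := by
  have l1 := hh.lt ha (h + 1) (by omega)
  have l2 := hh.lt ha (h + 2) (by omega)
  have s0 := hc.S_pred
  have s1 := hc.S_self
  have s2 := hc.S_succ
  have t := hh.tight
  obtain ⟨⟨hf, hT⟩, hS, hL⟩ := ha
  refine ⟨⟨?_, fun i => ?_⟩, fun i => ?_, fun i => ?_⟩
  · obtain ⟨M, N, -, hM, hN⟩ := exists_bounds hf
    refine finite_of_bounds (M := min M h) (N := max N (h + 2)) (fun i hi => ?_) fun i hi => ?_
    · rw [hc.of_ne _ (by omega) (by omega), hM _ (by omega)]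
    · rw [hc.of_ne _ (by omega) (by omega), hN _ (by omega)]
  · have t0 := hT i
    have v0 := hc.self
    have v1 := hc.succ
    by_cases h1 : i = h + 1
    · subst h1
      have v2 := hc.of_ne (h + 2) (by omega) (by omega)
      have v3 := hc.of_ne (h + 3) (by omega) (by omega)
      have t1 := hT (h - 1)
      simp only [S, L, sub_eq_add_neg, add_assoc, Int.reduceNeg, Int.reduceAdd, Int.add_zero] at *
      omega
    by_cases h2 : i = h
    · subst h2
      rw [hc.of_ne (i + 2) (by omega) (by omega)]
      omega
    by_cases h3 : i + 1 = h
    · subst h3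
      rw [hc.of_ne i (by omega) (by omega)]
      rw [add_assoc i 1 1] at *
      simp only [Int.reduceAdd] at *
      omega
    rw [hc.of_ne i (by omega) (by omega), hc.of_ne (i + 1) (by omega) (by omega)]
    by_cases h4 : i + 2 = h
    · subst h4
      omega
    rw [hc.of_ne (i + 2) (by omega) (by omega)]
    exact t0
  · by_cases h1 : i = h + 1
    · subst h1
      omega
    have := hS i
    by_cases h2 : i = h - 1
    · subst h2
      omega
    rwa [hc.S_of_ne h2 h1]
  · have := hL i
    rw [L_eq] at this l1 l2 t ⊢
    have n1 := hc.S_of_ne (j := i - 1)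
    have n2 := hc.S_of_ne (j := i)
    have n3 := hc.S_of_ne (j := i + 1)
    by_cases h1 : i = h + 1
    · subst h1
      have n3 := n3 (by omega) (by omega)
      simp only [sub_eq_add_neg, add_assoc, Int.reduceNeg, Int.reduceAdd, Int.add_zero] at *
      omega
    by_cases h2 : i = h + 2
    · subst h2
      have n3 := n3 (by omega) (by omega)
      have n2 := n2 (by omega) (by omega)
      simp only [sub_eq_add_neg, add_assoc, Int.reduceNeg, Int.reduceAdd, Int.add_zero] at *
      omega
    by_cases h3 : i = h
    · subst h3
      omega
    by_cases h4 : i = h - 1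
    · subst h4
      have n1 := n1 (by omega) (by omega)
      simp only [sub_eq_add_neg, add_assoc, Int.reduceNeg, Int.reduceAdd, Int.add_zero] at *
      omega
    by_cases h5 : i = h - 2
    · subst h5
      have n2 := n2 (by omega) (by omega)
      have n1 := n1 (by omega) (by omega)
      simp only [sub_eq_add_neg, add_assoc, Int.reduceNeg, Int.reduceAdd, Int.add_zero] at *
      omega
    rw [n1 (by omega) (by omega), n2 (by omega) (by omega), n3 (by omega) (by omega)]
    exact this

/-- Neither S nor L changes at h, and neither changes beyond h + 2. -/
theorem top_le (hc : IsMove h c c') (hh : IsTop k p c h) {g : ℤ} (hg : IsTop k p c' g) :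
    h ≤ g ∧ g ≤ h + 2 := by
  constructor
  · by_contra hlt
    exact hg.not_tight h (by omega) (hc.tight_iff.2 hh.tight)
  · by_contra hlt
    refine hh.not_tight g (by omega) ?_
    rw [← hc.L_of_gt (by omega), ← hc.S_of_ne (by omega) (by omega)]
    exact hg.tight

/-- Inversion of a right move, with Γ to be taken as `level`. If g = h the move lowered the excess
by one. Otherwise the last extra unit left h, and the particle restarts at h + 1 or h + 2 with the
largest excess that fits. -/
theorem isInsert (hc : IsMove h c c') (hp : p ≤ k) (he : IsCarry k (k - p) a e)
    (hcm : c ∈ CMax k p) (ham : a ∈ CMax k p)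
    (hh : IsTop k p c h) {g : ℤ} (hg : IsTop k p c' g) {y : ℕ} (hy : 0 < y)
    (hi : IsInsert k p a e g y c') (Γ : ℤ → ℤ) (hΓ : ∀ m, Γ (m + 1) + S a m + e m = Γ m + p) :
    ∃ x, 0 < x ∧ IsInsert k p a e h x c ∧ Γ h - x + 1 = Γ g - y := by
  obtain ⟨hge, hle⟩ := hc.top_le hh hg
  have i0 := hi.le
  have i1 := hi.S_pred
  have i2 := hi.S_self
  have m0 := hc.self
  have m1 := hc.succ
  have hS := hcm.2.1
  have hL := hcm.2.2
  rcases eq_or_lt_of_le hge with rfl | hlt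
  · refine ⟨y + 1, by omega, ⟨?_, fun j hj => ?_, ?_, ?_, fun j hj => ?_⟩, by push_cast; ring⟩
    · have b0 := hS (h - 1)
      have b1 := hL (h - 1)
      have b2 := hL (h - 2)
      have s0 := hc.S_pred
      have s1 := hc.S_self
      have s2 := hc.S_of_ne (j := h - 2) (by omega) (by omega)
      have s3 := hc.S_of_ne (j := h - 3) (by omega) (by omega)
      have j2 := hi.S_lt (j := h - 2) (by omega)
      have j3 := hi.S_lt (j := h - 3) (by omega)
      have e1 := he.eq (h - 1)
      rw [L_eq] at b1 b2
      clear hS hL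
      simp only [sub_eq_add_neg, add_assoc, Int.reduceNeg, Int.reduceAdd, Int.add_zero] at *
      omega
    · rw [← hc.of_ne j (by omega) (by omega), hi.lt j hj]
    · have := hi.self
      omega
    · rw [← hc.S_self, i2]
    · rw [← hc.of_ne j (by omega) (by omega), hi.gt j hj]
  have t := hc.tight_iff.2 hh.tight
  rw [L_eq] at t
  rcases eq_or_lt_of_le (show h + 1 ≤ g by omega) with rfl | hlt2
  · have y0 : y + S a h + e h = p := by
      have e1 := he.S_le h
      have j1 := hi.S_lt (j := h - 1) (by omega)
      simp only [sub_eq_add_neg, add_assoc, Int.reduceNeg, Int.reduceAdd, Int.add_zero] at *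
      omega
    have j0 := hi.lt h (by omega)
    refine ⟨1, by omega, ⟨?_, fun j hj => ?_, by omega, ?_, fun j hj => ?_⟩, ?_⟩
    · have b0 := hS (h - 1)
      have b1 := hL (h - 1)
      have b2 := hL (h - 2)
      have s0 := hc.S_pred
      have s1 := hc.S_self
      have s2 := hc.S_of_ne (j := h - 2) (by omega) (by omega)
      have s3 := hc.S_of_ne (j := h - 3) (by omega) (by omega)
      have j1 := hi.S_lt (j := h - 1) (by omega)
      have j2 := hi.S_lt (j := h - 2) (by omega)
      have j3 := hi.S_lt (j := h - 3) (by omega)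
      have e1 := he.eq (h - 1)
      have d0 := he.S_add_le hp ham.2.1 ham.2.2 (h - 1)
      rw [L_eq] at b1 b2
      clear hS hL hΓ
      simp only [sub_eq_add_neg, add_assoc, Int.reduceNeg, Int.reduceAdd, Int.add_zero] at *
      omega
    · rw [← hc.of_ne j (by omega) (by omega), hi.lt j (by omega)]
    · rw [← hc.S_self]
      rw [add_sub_cancel_right] at i1
      omega
    · rw [← hc.of_ne j (by omega) (by omega)]
      rcases eq_or_lt_of_le (show h + 2 ≤ j by omega) with rfl | h3
      · have := hi.apply_succ
        simp only [S, sub_eq_add_neg, add_assoc, Int.reduceNeg, Int.reduceAdd, Int.add_zero] at *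
        omega
      · exact hi.gt j (by omega)
    · have := hΓ h
      push_cast
      omega
  · have hg2 : g = h + 2 := by omega
    subst hg2
    have j0 := hi.lt h (by omega)
    have j1 := hi.lt (h + 1) (by omega)
    -- Position h + 1 is skipped because S a h + e h = p leaves no room for an excess there.
    have y0 : y + S a (h + 1) + e (h + 1) = p ∧ S a h + e h = p := by
      have b0 := hS h
      have b1 := hL h
      have b2 := hL (h + 1)
      have s0 := hc.S_pred
      have s1 := hc.S_self
      have s2 := hc.S_succ
      have s3 := hc.S_of_ne (j := h + 2) (by omega) (by omega)
      have j2 := hi.S_lt (j := h) (by omega)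
      have j3 := hi.S_lt (j := h - 1) (by omega)
      have e1 := he.eq (h + 1)
      have e2 := he.eq (h + 2)
      have n1 := hh.lt hcm (h + 1) (by omega)
      have n2 := hh.lt hcm (h + 2) (by omega)
      have d0 := he.S_add_le hp ham.2.1 ham.2.2 h
      have d1 := he.S_add_le hp ham.2.1 ham.2.2 (h + 1)
      have e3 := he.eq h
      rw [L_eq] at b1 b2 n1 n2
      clear hS hL hΓ
      simp only [sub_eq_add_neg, add_assoc, Int.reduceNeg, Int.reduceAdd, Int.add_zero] at *
      omega
    refine ⟨1, by omega, ⟨?_, fun j hj => ?_, by omega, ?_, fun j hj => ?_⟩, ?_⟩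
    · have b0 := hS (h - 1)
      have b1 := hL (h - 1)
      have b2 := hL (h - 2)
      have s0 := hc.S_pred
      have s1 := hc.S_self
      have s2 := hc.S_of_ne (j := h - 2) (by omega) (by omega)
      have s3 := hc.S_of_ne (j := h - 3) (by omega) (by omega)
      have j0' := hi.S_lt (j := h) (by omega)
      have j1 := hi.S_lt (j := h - 1) (by omega)
      have j2 := hi.S_lt (j := h - 2) (by omega)
      have j3 := hi.S_lt (j := h - 3) (by omega)
      have e1 := he.eq (h - 1)
      have d0 := he.S_add_le hp ham.2.1 ham.2.2 (h - 1)
      rw [L_eq] at b1 b2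
      clear hS hL hΓ
      simp only [sub_eq_add_neg, add_assoc, Int.reduceNeg, Int.reduceAdd, Int.add_zero] at *
      omega
    · rw [← hc.of_ne j (by omega) (by omega), hi.lt j (by omega)]
    · rw [← hc.S_self, hi.S_lt (by omega)]
      exact y0.2
    · rw [← hc.of_ne j (by omega) (by omega)]
      rcases eq_or_lt_of_le (show h + 2 ≤ j by omega) with rfl | h3
      · have := hi.self
        simp only [S, sub_eq_add_neg, add_assoc, Int.reduceNeg, Int.reduceAdd, Int.add_zero] at *
        omega
      rcases eq_or_lt_of_le (show h + 3 ≤ j by omega) with rfl | h3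
      · have := hi.apply_succ
        simp only [S, sub_eq_add_neg, add_assoc, Int.reduceNeg, Int.reduceAdd, Int.add_zero] at *
        omega
      · exact hi.gt j (by omega)
    · have g1 := hΓ h
      have g2 := hΓ (h + 1)
      simp only [add_assoc, Int.reduceAdd] at *
      push_cast
      omega

end IsMove

/-! ### Conservation of the total carry under right moves. -/

theorem finsum_add_ite {f : Config} (hf : {i : ℤ | f i ≠ 0}.Finite) (g : ℤ) (u : ℕ) :
    ∑ᶠ j, (f j + if j = g then u else 0) = ∑ᶠ j, f j + u := by
  rw [finsum_add_distrib hf, finsum_eq_single _ g (fun j hj => if_neg hj), if_pos rfl]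
  refine (Set.finite_singleton g).subset fun j hj => ?_
  by_contra hne
  exact hj (if_neg hne)

theorem finsum_eq_of_moved {f f' : Config} (hf : {i : ℤ | f i ≠ 0}.Finite)
    (hf' : {i : ℤ | f' i ≠ 0}.Finite) {g g' : ℤ} (hne : g ≠ g') (h1 : f' g' + 1 = f g')
    (h2 : f' g = f g + 1) (h3 : ∀ j, j ≠ g → j ≠ g' → f' j = f j) :
    ∑ᶠ j, f' j = ∑ᶠ j, f j := by
  have hff : ∀ j, (f' j + if j = g' then 1 else 0) = f j + if j = g then 1 else 0 := fun j => by
    by_cases hj : j = g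
    · subst hj
      rw [if_neg hne, if_pos rfl, h2]
    by_cases hj' : j = g'
    · subst hj'
      rw [if_neg hj, if_pos rfl, h1, add_zero]
    rw [if_neg hj, if_neg hj', h3 j hj hj']
  have h4 := finsum_add_ite hf g 1
  have h5 := finsum_add_ite hf' g' 1
  rw [finsum_congr hff] at h5
  omega

theorem eq_max_sub_iff {k q u A B e : ℕ} : e = max (A - k) (B - q - u) ↔
    A ≤ k + e ∧ B ≤ q + e + u ∧ (e = 0 ∨ e + k = A ∨ e + q + u = B) := by
  omega

/-- Local form of the conservation law. Here r + 1, s1, s2 are the S-sums at h - 1, h, h + 1 before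
a move at h, which changes them to r, s1, s2 + 1. The carries at h and h + 4 are unaffected, and
between them at most one unit of carry passes from h + 1 to h + 2 or h + 3. -/
theorem move_arith {k p q s r s1 s2 s3 e0 e1 e2 e3 e4 : ℕ}
    (h0 : e0 = max (s + (r + 1) - k) (r + 1 - q - e1))
    (h1 : e1 = max (r + 1 + s1 - k) (s1 - q - e2))
    (h2 : e2 = max (s1 + s2 - k) (s2 - q - e3)) (h3 : e3 = max (s2 + s3 - k) (s3 - q - e4))
    (hq : p + q ≤ k) (b0 : r + 1 ≤ p) (b1 : s1 ≤ p) (b2 : s2 < p)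
    (l0 : s + (r + 1) + s1 ≤ k + p) (l2 : s1 + s2 + s3 < k + p)
    (t : s1 = p ∨ r + 1 + s1 + s2 = k + p) :
    ∃ f1 f2 f3, f3 = max (s2 + 1 + s3 - k) (s3 - q - e4) ∧
      f2 = max (s1 + (s2 + 1) - k) (s2 + 1 - q - f3) ∧
      f1 = max (r + s1 - k) (s1 - q - f2) ∧
      e0 = max (s + r - k) (r - q - f1) ∧
      ((f1 = e1 ∧ f2 = e2 ∧ f3 = e3) ∨ (f1 + 1 = e1 ∧ f2 = e2 + 1 ∧ f3 = e3) ∨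
        f1 + 1 = e1 ∧ f2 = e2 ∧ f3 = e3 + 1) := by
  simp only [eq_max_sub_iff] at *
  obtain ⟨h0a, h0b, h0c⟩ := h0
  obtain ⟨h1a, h1b, h1c⟩ := h1
  obtain ⟨h2a, h2b, h2c⟩ := h2
  obtain ⟨h3a, h3b, h3c⟩ := h3
  -- The condition says that raising s2 by one raises the maximum defining e3.
  by_cases hA : k ≤ s2 + s3 ∧ s3 + k < s2 + s3 + 1 + q + e4
  · have t2 : r + 1 + s1 + s2 = k + p := by omega
    have k3 : e3 + k = s2 + s3 := by omega
    have k2 : e2 + q + e3 = s2 := by omega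
    have k1 : e1 + k = r + 1 + s1 ∧ 0 < e1 := by omega
    exact ⟨e1 - 1, e2, e3 + 1, by omega, by omega, by omega, by omega, by omega⟩
  have k3 : s2 + 1 + s3 ≤ k + e3 ∧ (e3 = 0 ∨ e3 + k = s2 + 1 + s3 ∨ e3 + q + e4 = s3) := by
    omega
  clear h3a h3c hA
  -- With e3 unchanged, the condition says that raising s2 by one raises the maximum defining e2.
  by_cases hB : k ≤ s1 + s2 ∨ q + e3 ≤ s2
  · have k2 : e2 + k = s1 + s2 ∨ e2 + q + e3 = s2 := by omega
    clear h2c hB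
    have hpos : 0 < e1 := by
      rcases t with t | t
      · rcases k2 with k2 | k2 <;> omega
      · omega
    obtain ⟨f1, rfl⟩ := Nat.exists_eq_succ_of_ne_zero hpos.ne'
    refine ⟨f1, e2 + 1, e3, ⟨k3.1, h3b, k3.2⟩, ⟨by omega, by omega, by omega⟩,
      ⟨by omega, by omega, by omega⟩, ⟨by omega, by omega, ?_⟩, by omega⟩
    clear k3 h3b l2
    rcases h0c with h | h | h
    · omega
    · have h3 : s + (r + 1) ≤ k + (p - s1) := by omega
      rcases t with t | t
      · omega
      · rcases h1c with h' | h' | h'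
        · omega
        · omega
        · omega
    · omega
  · have t2 : s1 = p := by omega
    subst t2
    have k2 : e2 = 0 := by omega
    exact ⟨e1, e2, e3, ⟨k3.1, h3b, k3.2⟩, by omega, by omega, by omega, by omega⟩
-- The carry here belongs to a particle of weight k - q ≥ p, not necessarily to the one being moved.
-- Only the entries at h + 1, h + 2, h + 3 can change.
theorem IsMove.exists_carry (hc : IsMove h c c') (hcm : c ∈ CMax k p) (hh : IsTop k p c h)
    (hq : p + q ≤ k) (he : IsCarry k q c e) :
    ∃ e', IsCarry k q c' e' ∧ (∀ j, j ≤ h → e' j = e j) ∧ ∑ᶠ j, e' j = ∑ᶠ j, e j := by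
  have hcm' := hc.mem_CMax hh hcm
  have s0 := hc.S_pred
  have s1 := hc.S_self
  have s2 := hc.S_succ
  have hS := hcm.2.1
  obtain ⟨f1, f2, f3, k3, k2, k1, k0, hf⟩ : ∃ f1 f2 f3,
      f3 = max (S c' (h + 1) + S c' (h + 2) - k) (S c' (h + 2) - q - e (h + 4)) ∧
      f2 = max (S c' h + S c' (h + 1) - k) (S c' (h + 1) - q - f3) ∧
      f1 = max (S c' (h - 1) + S c' h - k) (S c' h - q - f2) ∧
      e h = max (S c' (h - 2) + S c' (h - 1) - k) (S c' (h - 1) - q - f1) ∧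
      ((f1 = e (h + 1) ∧ f2 = e (h + 2) ∧ f3 = e (h + 3)) ∨
        (f1 + 1 = e (h + 1) ∧ f2 = e (h + 2) + 1 ∧ f3 = e (h + 3)) ∨
        f1 + 1 = e (h + 1) ∧ f2 = e (h + 2) ∧ f3 = e (h + 3) + 1) := by
    rw [s2, s1, hc.S_of_ne (j := h + 2) (by omega) (by omega),
      hc.S_of_ne (j := h - 2) (by omega) (by omega)]
    have e0 := he.eq h
    have e1 := he.eq (h + 1)
    have e2 := he.eq (h + 2)
    have e3 := he.eq (h + 3)
    have l0 := hcm.2.2 (h - 1)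
    have l1 := (hh.lt hcm (h + 1) (by omega)).2
    have n1 := (hh.lt hcm (h + 1) (by omega)).1
    have b0 := hS (h - 1)
    have b1 := hS h
    have t := hh.tight
    rw [L_eq] at l0 l1 t
    rw [show h - 1 - 1 = h - 2 by ring, sub_add_cancel] at l0
    rw [show h + 1 - 1 = h by ring, show h + 1 + 1 = h + 2 by ring] at l1
    rw [show h + 1 - 2 = h - 1 by ring, show h + 1 - 1 = h by ring,
      show h + 1 + 1 = h + 2 by ring] at e1
    rw [show h + 2 - 2 = h by ring, show h + 2 - 1 = h + 1 by ring,
      show h + 2 + 1 = h + 3 by ring] at e2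
    rw [show h + 3 - 2 = h + 1 by ring, show h + 3 - 1 = h + 2 by ring,
      show h + 3 + 1 = h + 4 by ring] at e3
    rw [← s0] at e0 e1 l0 b0 t
    exact move_arith e0 e1 e2 e3 hq b0 b1 n1 l0 l1 t
  let e' : Config := fun j =>
    if j = h + 1 then f1 else if j = h + 2 then f2 else if j = h + 3 then f3 else e j
  have g1 : e' (h + 1) = f1 := by simp [e']
  have g2 : e' (h + 2) = f2 := by simp [e']
  have g3 : e' (h + 3) = f3 := by simp [e']
  have gne : ∀ j, j ≠ h + 1 → j ≠ h + 2 → j ≠ h + 3 → e' j = e j := fun j h1 h2 h3 => by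
    simp only [e', if_neg h1, if_neg h2, if_neg h3]
  have hcar : IsCarry k q c' e' := by
    refine ⟨fun m => ?_, ?_⟩
    · by_cases m3 : m = h + 3
      · subst m3
        rw [show h + 3 - 2 = h + 1 by ring, show h + 3 - 1 = h + 2 by ring,
          show h + 3 + 1 = h + 4 by ring, gne (h + 4) (by omega) (by omega) (by omega), g3, k3]
      by_cases m2 : m = h + 2
      · subst m2
        rw [show h + 2 - 2 = h by ring, show h + 2 - 1 = h + 1 by ring,
          show h + 2 + 1 = h + 3 by ring, g2, g3, k2]
      by_cases m1 : m = h + 1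
      · subst m1
        rw [show h + 1 - 2 = h - 1 by ring, show h + 1 - 1 = h by ring,
          show h + 1 + 1 = h + 2 by ring, g1, g2, k1]
      by_cases m0 : m = h
      · subst m0
        rw [g1, gne _ (by omega) (by omega) (by omega), k0]
      rw [gne m m1 m2 m3, gne (m + 1) (by omega) (by omega) (by omega),
        hc.S_of_ne (by omega) (by omega), hc.S_of_ne (by omega) (by omega), he.eq]
    · obtain ⟨N, hN⟩ := he.right
      exact ⟨max N (h + 4), fun m hm => by
        rw [gne _ (by omega) (by omega) (by omega), hN _ (by omega)]⟩
  refine ⟨e', hcar, fun j hj => gne j (by omega) (by omega) (by omega), ?_⟩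
  have hfe := he.finite hcm.1
  have hfe' := hcar.finite hcm'.1
  rcases hf with ⟨q1, q2, q3⟩ | ⟨q1, q2, q3⟩ | ⟨q1, q2, q3⟩
  · refine finsum_congr fun j => ?_
    by_cases j1 : j = h + 1
    · rw [j1, g1, q1]
    by_cases j2 : j = h + 2
    · rw [j2, g2, q2]
    by_cases j3 : j = h + 3
    · rw [j3, g3, q3]
    exact gne j j1 j2 j3
  · refine finsum_eq_of_moved hfe hfe' (g := h + 2) (g' := h + 1) (by omega) (by rw [g1, q1])
      (by rw [g2, q2]) fun j j2 j1 => ?_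
    by_cases j3 : j = h + 3
    · rw [j3, g3, q3]
    exact gne j j1 j2 j3
  · refine finsum_eq_of_moved hfe hfe' (g := h + 3) (g' := h + 1) (by omega) (by rw [g1, q1])
      (by rw [g3, q3]) fun j j3 j1 => ?_
    by_cases j2 : j = h + 2
    · rw [j2, g2, q2]
    exact gne j j1 j2 j3

/-! ### Removal of a free particle. -/

/-- A free particle of weight `p` at its highest position `h`. -/
structure IsFreeAt (p : ℕ) (a : Config) (h : ℤ) : Prop where
  S_eq : S a h = p
  ne : a h ≠ 0
  zero : ∀ j, h + 2 ≤ j → a j = 0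

theorem cutLeft_lt {j : ℤ} (hj : j < h) : cutLeft h a j = a j := if_pos hj

theorem cutLeft_ge {j : ℤ} (hj : h ≤ j) : cutLeft h a j = 0 := if_neg (by omega)

/-- The truncated p - q is the term (p + p' - k)_+ of `A` for p' = k - q: a free particle adds this
much to the carry, at h + 1 and h + 2 only. -/
theorem IsFreeAt.carry_cutLeft (hf : IsFreeAt p a h) (ham : a ∈ CMax k p) (hq : p + q ≤ k)
    (he : IsCarry k q a e) :
    IsCarry k q (cutLeft h a) (fun j => if j ≤ h then e j else 0) ∧
      e (h + 1) + e (h + 2) = p - q ∧ ∀ j, h + 2 < j → e j = 0 := by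
  have hz : ∀ j, h + 2 < j → e j = 0 := fun j hj =>
    he.eq_zero_right ham.1.2 hf.zero j hj
  have t0 := ham.1.2 (h - 1)
  have l0 := ham.2.2 (h - 1)
  have b0 := ham.2.1 (h - 1)
  have e0 := he.eq h
  have e1 := he.eq (h + 1)
  have e2 := he.eq (h + 2)
  have z3 := hz (h + 3) (by omega)
  have z2 := hf.zero (h + 2) (by omega)
  have hs := hf.S_eq
  have c1 := cutLeft_lt (a := a) (show h - 1 < h by omega)
  have c2 := cutLeft_lt (a := a) (show h - 2 < h by omega)
  have c3 := cutLeft_ge (a := a) (le_refl h)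
  have hsum : e (h + 1) + e (h + 2) = p - q := by
    simp only [S, L, sub_eq_add_neg, add_assoc, Int.reduceNeg, Int.reduceAdd, Int.add_zero] at *
    omega
  refine ⟨⟨fun m => ?_, h + 1, fun m hm => if_neg (by omega)⟩, hsum, hz⟩
  rcases lt_or_ge h m with hm | hm
  · rw [if_neg (by omega)]
    have g1 := cutLeft_ge (a := a) (show h ≤ m - 1 by omega)
    have g2 := cutLeft_ge (a := a) (show h ≤ m - 1 + 1 by omega)
    have g3 : cutLeft h a (m - 2) ≤ a (m - 2) := by
      simp only [cutLeft]; split_ifs <;> omega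
    have g4 := ham.1.2 (m - 2)
    have g5 : cutLeft h a (m - 2 + 1) = 0 := cutLeft_ge (by omega)
    simp only [S]
    omega
  rw [if_pos hm]
  rcases eq_or_lt_of_le hm with rfl | hlt
  · rw [if_neg (by omega)]
    simp only [S, L, sub_eq_add_neg, add_assoc, Int.reduceNeg, Int.reduceAdd, Int.add_zero] at *
    omega
  · rw [if_pos (by omega), he.eq, S, S, S, S, cutLeft_lt (by omega), cutLeft_lt (by omega),
      cutLeft_lt (by omega), cutLeft_lt (by omega)]

theorem IsFreeAt.exists_carry (hf : IsFreeAt p a h) (ham : a ∈ CMax k p) (hq : p + q ≤ k)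
    (he : IsCarry k q a e) :
    ∃ e', IsCarry k q (cutLeft h a) e' ∧ (∀ j, j ≤ h → e' j = e j) ∧
      ∑ᶠ j, e j = ∑ᶠ j, e' j + (p - q) := by
  obtain ⟨h1, h2, h3⟩ := hf.carry_cutLeft ham hq he
  refine ⟨_, h1, fun j hj => if_pos hj, ?_⟩
  have hfin : {i : ℤ | (fun j => if j ≤ h then e j else 0) i ≠ 0}.Finite := by
    refine (he.finite ham.1).subset fun i hi => ?_
    simp only [Set.mem_ofPred_eq] at hi ⊢
    intro h0
    rw [h0] at hi
    simp at hi
  rw [← h2, ← add_assoc, ← finsum_add_ite hfin (h + 1), ← finsum_add_ite _ (h + 2)]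
  · refine finsum_congr fun j => ?_
    by_cases j1 : j = h + 1
    · subst j1; simp
    by_cases j2 : j = h + 2
    · subst j2; simp
    rw [if_neg j1, if_neg j2]
    split_ifs with hj
    · rfl
    · rw [h3 j (by omega)]
  · refine ((he.finite ham.1).union (Set.finite_singleton (h + 1))).subset fun i hi => ?_
    by_contra hcon
    simp only [Set.mem_union, Set.mem_ofPred_eq, Set.mem_singleton_iff, not_or, not_not] at hcon hi
    apply hi
    rw [if_neg hcon.2, hcon.1]
    simp

/-! ### Maximal weight, highest positions and termination of the right moves. -/

theorem C_subset_CMax (ha : a ∈ C k) : a ∈ CMax k k := by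
  refine ⟨ha, fun i => ?_, fun i => ?_⟩
  · have := ha.2 i
    rw [S]
    omega
  · have h1 := ha.2 (i - 1)
    have h2 := ha.2 i
    simp only [L, sub_eq_add_neg, add_assoc, Int.reduceNeg, Int.reduceAdd, Int.add_zero] at *
    omega

theorem mem_CMax_weight (ha : a ∈ C k) : a ∈ CMax k (weight k a) :=
  Nat.sInf_mem (s := {l | a ∈ CMax k l}) ⟨k, C_subset_CMax ha⟩

theorem weight_le (ha : a ∈ CMax k p) : weight k a ≤ p := Nat.sInf_le ha

theorem weight_pos (ha : a ∈ C k) (h0 : a ≠ 0) : 0 < weight k a := by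
  by_contra hcon
  apply h0
  funext i
  have := (mem_CMax_weight ha).2.1 i
  rw [S] at this
  simp only [Pi.zero_apply]
  omega

/-- `a` has maximal weight exactly `p > 0`. -/
structure HasWeight (k p : ℕ) (a : Config) : Prop where
  pos : 0 < p
  le : p ≤ k
  mem : a ∈ CMax k p
  top : ∃ h, IsTop k p a h

theorem exists_isTop (hp : 0 < p) (ha : a ∈ C k) {i : ℤ} (hi : S a i = p ∨ L a i = k + p) :
    ∃ h, IsTop k p a h ∧ i ≤ h := by
  obtain ⟨M, N, -, hM, hN⟩ := exists_bounds ha.1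
  obtain ⟨h, h1, h2⟩ := Int.exists_greatest_of_bdd (P := fun i => S a i = p ∨ L a i = k + p)
    ⟨N + 1, fun z hz => by
      by_contra hlt
      have v0 := hN (z - 1) (by omega)
      have v1 := hN z (by omega)
      have v2 := hN (z + 1) (by omega)
      have v3 := hN (z + 2) (by omega)
      simp only [S, L] at hz
      omega⟩ ⟨i, hi⟩
  refine ⟨h, ⟨h1, fun j hj hcon => ?_⟩, h2 i hi⟩
  have := h2 j hcon
  omega

theorem hasWeight_weight (ha : a ∈ C k) (h0 : a ≠ 0) : HasWeight k (weight k a) a := by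
  have hpos := weight_pos ha h0
  have hm := mem_CMax_weight ha
  refine ⟨hpos, weight_le (C_subset_CMax ha), hm, ?_⟩
  have hn : a ∉ CMax k (weight k a - 1) := fun hcon => by
    have := weight_le hcon
    omega
  have : ∃ i, S a i = weight k a ∨ L a i = k + weight k a := by
    by_contra hcon
    push Not at hcon
    refine hn ⟨ha, fun i => ?_, fun i => ?_⟩
    · have h1 := (hcon i).1
      have h2 := hm.2.1 i
      omega
    · have h1 := (hcon i).2
      have h2 := hm.2.2 i
      omega
  obtain ⟨i, hi⟩ := this
  obtain ⟨h, hh, -⟩ := exists_isTop hpos ha hi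
  exact ⟨h, hh⟩

namespace HasWeight

theorem weight_eq (ha : HasWeight k p a) : weight k a = p := by
  refine le_antisymm (weight_le ha.mem) ?_
  obtain ⟨h, hh⟩ := ha.top
  have hm := mem_CMax_weight ha.mem.1
  have h1 := hm.2.1 h
  have h2 := hm.2.2 h
  have h3 := hh.tight
  omega

theorem ne_zero (ha : HasWeight k p a) : a ≠ 0 := by
  rintro rfl
  obtain ⟨h, hh⟩ := ha.top
  have h1 := ha.pos
  have h3 := hh.tight
  simp only [S, L, Pi.zero_apply] at h3
  omega

end HasWeight

theorem IsTop.highest_eq (hh : IsTop k p a h) : highest k p a = h := by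
  refine IsGreatest.csSup_eq ⟨hh.tight, fun j hj => ?_⟩
  by_contra hlt
  exact hh.not_tight j (by omega) hj

theorem IsTop.isMove (hh : IsTop k p a h) (ha : a ∈ CMax k p) : IsMove h a (rightMove k p a) := by
  have hpos := hh.apply_pos ha
  refine ⟨?_, ?_, fun j h1 h2 => ?_⟩
  · simp only [rightMove, hh.highest_eq]
    rw [if_neg (by omega), if_pos trivial]
    omega
  · simp only [rightMove, hh.highest_eq]
    rw [if_pos trivial]
  · simp only [rightMove, hh.highest_eq]
    rw [if_neg h2, if_neg h1]

theorem HasWeight.rightMove (ha : HasWeight k p a) : HasWeight k p (rightMove k p a) := by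
  obtain ⟨h, hh⟩ := ha.top
  have hm := hh.isMove ha.mem
  have hc := hm.mem_CMax hh ha.mem
  obtain ⟨g, hg, -⟩ := exists_isTop ha.pos hc.1 (hm.tight_iff.2 hh.tight)
  exact ⟨ha.pos, ha.le, hc, g, hg⟩

theorem HasWeight.iterate (ha : HasWeight k p a) (t : ℕ) :
    HasWeight k p ((RiggedConf.rightMove k p)^[t] a) := by
  induction t with
  | zero => exact ha
  | succ t ih => rw [Function.iterate_succ_apply']; exact ih.rightMove

theorem IsTop.isFree_iff (hh : IsTop k p a h) : IsFree k p a ↔ IsFreeAt p a h := by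
  rw [IsFree, hh.highest_eq]
  exact ⟨fun ⟨h1, h2, h3⟩ => ⟨h1, h2, h3⟩, fun h1 => ⟨h1.1, h1.2, h1.3⟩⟩

/-- The energy `i a_i + (i+1) a_{i+1}` of the two entries at `h`. -/
def pairEnergy (a : Config) (h : ℤ) : ℤ := h * (a h : ℤ) + (h + 1) * (a (h + 1) : ℤ)

/-- Extra moves after the particle is free raise energy and move count alike and leave the rest
alone, so d - t is well defined. The top advances only when all p units have reached h + 1. -/
theorem IsFreeAt.rightMove (hf : IsFreeAt p a h) (ha : HasWeight k p a) (hh : IsTop k p a h) :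
    ∃ g, IsTop k p (rightMove k p a) g ∧ IsFreeAt p (rightMove k p a) g ∧
      cutLeft g (rightMove k p a) = cutLeft h a ∧
      pairEnergy (rightMove k p a) g = pairEnergy a h + 1 := by
  obtain ⟨g, hg⟩ := ha.rightMove.top
  have hm := hh.isMove ha.mem
  have hgb := hm.top_le hh hg
  have m0 := hm.self
  have m1 := hm.succ
  have m2 := hm.of_ne (h + 2) (by omega) (by omega)
  have m3 := hm.of_ne (h + 3) (by omega) (by omega)
  have m4 := hm.of_ne (h + 4) (by omega) (by omega)
  have z2 := hf.zero (h + 2) (by omega)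
  have z3 := hf.zero (h + 3) (by omega)
  have z4 := hf.zero (h + 4) (by omega)
  have hs := hf.S_eq
  have hpk := ha.le
  have hp := ha.pos
  have ht := hg.tight
  have hpos := hg.apply_pos ha.rightMove.mem
  rw [S] at hs
  rw [z2] at m2
  refine ⟨g, hg, ?_⟩
  rcases eq_or_lt_of_le hgb.1 with rfl | hlt
  · refine ⟨⟨by rw [hm.S_self, hf.S_eq], by omega, fun j hj => ?_⟩, ?_, ?_⟩
    · rw [hm.of_ne j (by omega) (by omega), hf.zero j hj]
    · funext j
      simp only [cutLeft]
      split_ifs with hj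
      · rw [hm.of_ne j (by omega) (by omega)]
      · rfl
    · simp only [pairEnergy, ← m0, m1]
      push_cast
      ring
  · have hg1 : g = h + 1 := by
      by_contra hne
      rw [show g = h + 2 by omega] at hpos
      omega
    subst hg1
    have v1 : RiggedConf.rightMove k p a (h + 1) = p := by
      simp only [S, L, sub_eq_add_neg, add_assoc, Int.reduceNeg, Int.reduceAdd, Int.add_zero] at *
      omega
    have v0 : RiggedConf.rightMove k p a h = 0 := by omega
    have v2 : RiggedConf.rightMove k p a (h + 1 + 1) = 0 := by
      rw [add_assoc]
      exact m2
    refine ⟨⟨by rw [S, v1, v2]; rfl, by omega, fun j hj => ?_⟩, ?_, ?_⟩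
    · rw [hm.of_ne j (by omega) (by omega), hf.zero j (by omega)]
    · funext j
      simp only [cutLeft]
      by_cases hj : j < h
      · rw [if_pos hj, if_pos (by omega), hm.of_ne j (by omega) (by omega)]
      · rw [if_neg hj]
        split_ifs with h1
        · rw [show j = h by omega, v0]
        · rfl
    · have u0 : a h = 1 := by omega
      have u1 : (a (h + 1) : ℤ) + 1 = p := by omega
      simp only [pairEnergy, v1, v2, u0]
      push_cast
      linear_combination (-(h + 1)) * u1

/-- Termination: the potential ∑ a_j (N + 2 - j) drops by one with every move, as long as the top
stays below N + 1. -/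
theorem HasWeight.exists_isFree (ha : HasWeight k p a) :
    ∃ t, IsFree k p ((RiggedConf.rightMove k p)^[t] a) := by
  obtain ⟨M, N, hMN, hM, hN⟩ := exists_bounds ha.mem.1.1
  have key : ∀ n : ℕ, ∀ a : Config, HasWeight k p a → (∀ i, i < M → a i = 0) →
      (∀ i, N + 2 ≤ i → a i = 0) →
      ∑ j ∈ Finset.Ico M (N + 2), (a j : ℤ) * (N + 2 - j) ≤ n →
      ∃ t, IsFree k p ((RiggedConf.rightMove k p)^[t] a) := by
    intro n
    induction n with
    | zero =>
      intro a ha hM hN hn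
      exfalso
      obtain ⟨h, hh⟩ := ha.top
      have hpos := hh.apply_pos ha.mem
      have h1 : M ≤ h := by
        by_contra hlt
        rw [hM h (by omega)] at hpos
        omega
      have h2 : h < N + 2 := by
        by_contra hlt
        rw [hN h (by omega)] at hpos
        omega
      have h3 := Finset.single_le_sum (f := fun j => (a j : ℤ) * (N + 2 - j))
        (fun j hj => mul_nonneg (by positivity) (by have := (Finset.mem_Ico.1 hj).2; omega))
        (Finset.mem_Ico.2 ⟨h1, h2⟩)
      have h4 : (0 : ℤ) < (a h : ℤ) * (N + 2 - h) := mul_pos (by omega) (by omega)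
      push_cast at hn
      omega
    | succ n ih =>
      intro a ha hM hN hn
      obtain ⟨h, hh⟩ := ha.top
      have hpos := hh.apply_pos ha.mem
      have h1 : M ≤ h := by
        by_contra hlt
        rw [hM h (by omega)] at hpos
        omega
      -- A top at N + 1 has nothing to its right, so L = k + p there together with S ≤ p ≤ k already
      -- forces S = p, and the particle is free.
      by_cases hNh : N + 1 ≤ h
      · refine ⟨0, (hh.isFree_iff (a := a)).2 ⟨?_, by omega, fun j hj => hN j (by omega)⟩⟩
        have hhN : h = N + 1 := by
          by_contra hlt
          rw [hN h (by omega)] at hpos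
          omega
        have t := hh.tight
        have v1 := hN (h + 1) (by omega)
        have v2 := hN (h + 2) (by omega)
        have s1 := ha.mem.2.1 (h - 1)
        have s2 := ha.mem.2.1 h
        have hk := ha.le
        simp only [S, L, sub_add_cancel] at *
        omega
      · have hm := hh.isMove ha.mem
        obtain ⟨t, ht⟩ := ih _ ha.rightMove
          (fun i hi => by rw [hm.of_ne i (by omega) (by omega), hM i hi])
          (fun i hi => by rw [hm.of_ne i (by omega) (by omega), hN i hi]) (by
            have hsum : ∑ j ∈ Finset.Ico M (N + 2),
                (RiggedConf.rightMove k p a j : ℤ) * (N + 2 - j) + 1 =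
                ∑ j ∈ Finset.Ico M (N + 2), (a j : ℤ) * (N + 2 - j) := by
              have e1 : ∀ j : ℤ, (RiggedConf.rightMove k p a j : ℤ) * (N + 2 - j) =
                  (a j : ℤ) * (N + 2 - j) + ((if j = h + 1 then (N + 1 - h) else 0) -
                  (if j = h then (N + 2 - h) else 0)) := by
                intro j
                by_cases j1 : j = h
                · subst j1
                  have := hm.self
                  rw [if_neg (by omega), if_pos rfl, ← this]
                  push_cast
                  ring
                by_cases j2 : j = h + 1
                · subst j2
                  rw [if_pos rfl, if_neg (by omega), hm.succ]
                  push_cast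
                  ring
                rw [if_neg j2, if_neg j1, hm.of_ne j j1 j2]
                ring
              rw [Finset.sum_congr rfl fun j _ => e1 j, Finset.sum_add_distrib,
                Finset.sum_sub_distrib, Finset.sum_ite_eq', Finset.sum_ite_eq',
                if_pos (Finset.mem_Ico.2 ⟨by omega, by omega⟩),
                if_pos (Finset.mem_Ico.2 ⟨by omega, by omega⟩)]
              ring
            push_cast at hn
            omega)
        exact ⟨t + 1, by rwa [Function.iterate_succ_apply]⟩
  exact key (∑ j ∈ Finset.Ico M (N + 2), (a j : ℤ) * (N + 2 - j)).toNat a ha hM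
    (fun i hi => hN i (by omega)) (by omega)

theorem IsMove.length_eq (hm : IsMove h c c') (hc : {i : ℤ | c i ≠ 0}.Finite)
    (hc' : {i : ℤ | c' i ≠ 0}.Finite) : length c' = length c :=
  finsum_eq_of_moved hc hc' (by omega) hm.self hm.succ fun j h1 h2 => hm.of_ne j h2 h1

theorem cutLeft_mem_CMax (ha : a ∈ CMax k p) : cutLeft h a ∈ CMax k p := by
  have hle : ∀ i, cutLeft h a i ≤ a i := fun i => by
    simp only [cutLeft]
    split_ifs <;> omega
  refine ⟨⟨ha.1.1.subset fun i hi => ?_, fun i => ?_⟩, fun i => ?_, fun i => ?_⟩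
  · simp only [Set.mem_ofPred_eq] at *
    have := hle i
    omega
  · have h1 := ha.1.2 i
    have := hle i
    have := hle (i + 1)
    have := hle (i + 2)
    omega
  · have h1 := ha.2.1 i
    have := hle i
    have := hle (i + 1)
    simp only [S] at *
    omega
  · have h1 := ha.2.2 i
    have := hle (i - 1)
    have := hle i
    have := hle (i + 1)
    have := hle (i + 2)
    simp only [L] at *
    omega

theorem IsFreeAt.length_eq (hf : IsFreeAt p a h) (ha : a ∈ CMax k p) :
    length a = length (cutLeft h a) + p := by
  have hfin : {i : ℤ | cutLeft h a i ≠ 0}.Finite := (cutLeft_mem_CMax (h := h) ha).1.1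
  rw [length, length, ← hf.S_eq, S, ← add_assoc, ← finsum_add_ite hfin h,
    ← finsum_add_ite _ (h + 1)]
  · refine finsum_congr fun j => ?_
    by_cases j1 : j = h
    · subst j1; simp [cutLeft]
    by_cases j2 : j = h + 1
    · subst j2; simp [cutLeft]
    rw [if_neg j1, if_neg j2]
    simp only [cutLeft]
    split_ifs with hj
    · rfl
    · rw [hf.zero j (by omega)]
  · refine (hfin.union (Set.finite_singleton h)).subset fun i hi => ?_
    by_contra hcon
    simp only [Set.mem_union, Set.mem_ofPred_eq, Set.mem_singleton_iff, not_or, not_not] at hcon hi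
    apply hi
    rw [if_neg hcon.2, hcon.1]

/-! ### Extraction of the highest particle and the recursion for `iota`. -/

/-- `Extract k p a b s`: removing the highest particle of weight `p` from `a` leaves `b`, and
`s = d - t` is its energy corrected by the number of moves. -/
inductive Extract (k p : ℕ) : Config → Config → ℤ → Prop
  | free {a : Config} {h : ℤ} (ha : HasWeight k p a) (hh : IsTop k p a h) (hf : IsFreeAt p a h) :
      Extract k p a (cutLeft h a) (pairEnergy a h)
  | move {a b : Config} {s : ℤ} (ha : HasWeight k p a) (he : Extract k p (rightMove k p a) b s) :
      Extract k p a b (s - 1)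

namespace Extract

theorem hasWeight (he : Extract k p a b s) : HasWeight k p a := by
  cases he <;> assumption

theorem next (he : Extract k p a b s) : Extract k p (RiggedConf.rightMove k p a) b (s + 1) := by
  cases he with
  | free ha hh hf =>
    obtain ⟨g, hg, hf', hc, hE⟩ := hf.rightMove ha hh
    rw [← hc, ← hE]
    exact free ha.rightMove hg hf'
  | move ha he => rwa [sub_add_cancel]

theorem of_isFreeAt (he : Extract k p a b s) (hh : IsTop k p a h) (hf : IsFreeAt p a h) :
    b = cutLeft h a ∧ s = pairEnergy a h := by
  induction he generalizing h with
  | free ha hh' hf' =>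
    rw [← hh.highest_eq, hh'.highest_eq]
    exact ⟨rfl, rfl⟩
  | move ha he ih =>
    obtain ⟨g, hg, hf', hc, hE⟩ := hf.rightMove ha hh
    obtain ⟨h1, h2⟩ := ih hg hf'
    rw [h1, h2, hc, hE]
    exact ⟨rfl, by ring⟩

theorem iterate (he : Extract k p a b s) (t : ℕ) :
    Extract k p ((RiggedConf.rightMove k p)^[t] a) b (s + t) := by
  induction t with
  | zero => simpa using he
  | succ t ih =>
    rw [Function.iterate_succ_apply']
    have := ih.next
    rwa [add_assoc] at this

theorem mem_CMax (he : Extract k p a b s) : b ∈ CMax k p := by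
  induction he with
  | free ha hh hf => exact cutLeft_mem_CMax ha.mem
  | move ha he ih => exact ih

theorem length_eq (he : Extract k p a b s) : length a = length b + p := by
  induction he with
  | free ha hh hf => exact hf.length_eq ha.mem
  | move ha he ih =>
    obtain ⟨h, hh⟩ := ha.top
    rw [← ih, (hh.isMove ha.mem).length_eq ha.mem.1.1 ha.rightMove.mem.1.1]

end Extract

theorem HasWeight.exists_extract (ha : HasWeight k p a) : ∃ b s, Extract k p a b s := by
  obtain ⟨t, ht⟩ := ha.exists_isFree
  induction t generalizing a with
  | zero =>
    obtain ⟨h, hh⟩ := ha.top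
    exact ⟨_, _, .free ha hh (hh.isFree_iff.1 ht)⟩
  | succ t ih =>
    rw [Function.iterate_succ_apply] at ht
    obtain ⟨b, s, he⟩ := ih ha.rightMove ht
    exact ⟨b, _, .move ha he⟩

theorem iotaAux_zero (k n : ℕ) : iotaAux k n 0 = [] := by
  cases n <;> simp [iotaAux]

theorem Extract.iotaAux_succ {s : ℤ} (he : Extract k p a b s) (n : ℕ) :
    iotaAux k (n + 1) a =
      (p, s - ((iotaAux k n b).map fun r => (A k p r.1 : ℤ)).sum) :: iotaAux k n b := by
  have ha := he.hasWeight
  have hfree : IsFree k p ((RiggedConf.rightMove k p)^[freeTime k p a] a) :=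
    Nat.sInf_mem (s := {t | IsFree k p ((RiggedConf.rightMove k p)^[t] a)}) ha.exists_isFree
  obtain ⟨h, hh⟩ := (ha.iterate (freeTime k p a)).top
  obtain ⟨h1, h2⟩ := (he.iterate (freeTime k p a)).of_isFreeAt hh (hh.isFree_iff.1 hfree)
  rw [iotaAux, if_neg ha.ne_zero]
  simp only [ha.weight_eq, hh.highest_eq, ← h1]
  rw [pairEnergy] at h2
  rw [← h2, add_sub_cancel_right]

theorem length_eq_zero (ha : a ∈ C k) (h0 : length a = 0) : a = 0 := by
  by_contra hne
  obtain ⟨b, s, he⟩ := (hasWeight_weight ha hne).exists_extract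
  have h1 := he.length_eq
  have h2 := he.hasWeight.pos
  omega

/-- Each extraction shortens the configuration by p ≥ 1, so fuel beyond the length has no effect. -/
theorem iotaAux_eq (n : ℕ) : ∀ a ∈ C k, length a ≤ n → ∀ m, length a ≤ m →
    iotaAux k n a = iotaAux k m a := by
  induction n with
  | zero =>
    intro a ha h0 m hm
    rw [length_eq_zero ha (by omega), iotaAux_zero, iotaAux_zero]
  | succ n ih =>
    intro a ha hn m hm
    by_cases hne : a = 0
    · rw [hne, iotaAux_zero, iotaAux_zero]
    obtain ⟨b, s, he⟩ := (hasWeight_weight ha hne).exists_extract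
    have h1 := he.length_eq
    have h2 := he.hasWeight.pos
    obtain ⟨m, rfl⟩ := Nat.exists_eq_succ_of_ne_zero (show m ≠ 0 by omega)
    rw [he.iotaAux_succ, he.iotaAux_succ, ih b he.mem_CMax.1 (by omega) m (by omega)]

theorem iota_zero (k : ℕ) : iota k 0 = [] := iotaAux_zero _ _

theorem Extract.iota_eq {s : ℤ} (he : Extract k p a b s) :
    iota k a = (p, s - ((iota k b).map fun r => (A k p r.1 : ℤ)).sum) :: iota k b := by
  have h1 := he.length_eq
  have h2 := he.hasWeight.pos
  rw [iota, show length a = length a - 1 + 1 by omega, he.iotaAux_succ,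
    iotaAux_eq (length a - 1) b he.mem_CMax.1 (by omega) (length b) le_rfl]
  rfl

/-! ### Levels, and the rigging as a level. -/

/-- The partial sum `∑_{j < m} f_j`. -/
noncomputable def prefixSum (f : Config) (m : ℤ) : ℕ := ∑ᶠ j : ℤ, if j < m then f j else 0

theorem prefixSum_succ {f : Config} (hf : {i : ℤ | f i ≠ 0}.Finite) (m : ℤ) :
    prefixSum f (m + 1) = prefixSum f m + f m := by
  have hfin : {i : ℤ | (fun j => if j < m then f j else 0) i ≠ 0}.Finite :=
    hf.subset fun i hi => by
      simp only [Set.mem_ofPred_eq] at *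
      intro h0
      rw [h0] at hi
      simp at hi
  rw [prefixSum, prefixSum, ← finsum_add_ite hfin m]
  refine finsum_congr fun j => ?_
  by_cases hj : j = m
  · subst hj; simp
  · rw [if_neg hj, add_zero]
    exact if_congr (by omega) rfl rfl

theorem prefixSum_eq_zero {f : Config} {m : ℤ} (hf : ∀ j, j < m → f j = 0) : prefixSum f m = 0 := by
  refine (finsum_congr fun j => ?_).trans finsum_zero
  split_ifs with hj
  · exact hf j hj
  · rfl

theorem prefixSum_eq_finsum {f : Config} {m : ℤ} (hf : ∀ j, m ≤ j → f j = 0) :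
    prefixSum f m = ∑ᶠ j, f j := by
  refine finsum_congr fun j => ?_
  split_ifs with hj
  · rfl
  · exact (hf j (by omega)).symm

theorem prefixSum_le_finsum {f : Config} (hf : {i : ℤ | f i ≠ 0}.Finite) (m : ℤ) :
    prefixSum f m ≤ ∑ᶠ j, f j := by
  obtain ⟨M, N, -, -, hN⟩ := exists_bounds hf
  have key : ∀ n : ℕ, prefixSum f m ≤ prefixSum f (m + n) := by
    intro n
    induction n with
    | zero => simp
    | succ n ih =>
      have := prefixSum_succ hf (m + n)
      push_cast
      rw [← add_assoc]
      omega
  refine (key (N - m).toNat).trans (prefixSum_eq_finsum fun j hj => hN j (by omega)).le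

/-- The number of units displaced by a particle that passes between `j` and `j + 1`. -/
def flux (b e : Config) : Config := fun j => S b j + e j

theorem finite_S (hb : {i : ℤ | b i ≠ 0}.Finite) : {i : ℤ | S b i ≠ 0}.Finite := by
  obtain ⟨M, N, -, hM, hN⟩ := exists_bounds hb
  refine finite_of_bounds (M := M - 1) (N := N) (fun i hi => ?_) fun i hi => ?_
  · rw [S, hM _ (by omega), hM _ (by omega)]
  · rw [S, hN _ (by omega), hN _ (by omega)]

theorem finite_flux (hb : b ∈ C k) (he : IsCarry k q b e) : {i : ℤ | flux b e i ≠ 0}.Finite := by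
  refine ((finite_S hb.1).union (he.finite hb)).subset fun i hi => ?_
  by_contra hcon
  simp only [Set.mem_union, Set.mem_ofPred_eq, not_or, not_not, flux] at hcon hi
  omega

theorem finsum_flux (hb : b ∈ C k) (he : IsCarry k q b e) :
    ∑ᶠ j, flux b e j = 2 * length b + ∑ᶠ j, e j := by
  have h1 : ∑ᶠ j, S b j = 2 * length b := by
    have hsh : ∑ᶠ j : ℤ, b (j + 1) = ∑ᶠ j, b j := finsum_comp_equiv (Equiv.addRight (1 : ℤ))
    have hfin : {i : ℤ | b (i + 1) ≠ 0}.Finite := by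
      obtain ⟨M, N, -, hM, hN⟩ := exists_bounds hb.1
      exact finite_of_bounds (a := fun i => b (i + 1)) (M := M - 1) (N := N)
        (fun i hi => hM _ (by omega)) fun i hi => hN _ (by omega)
    simp only [S]
    rw [finsum_add_distrib hb.1 hfin, hsh, length]
    ring
  simp only [flux]
  rw [finsum_add_distrib (finite_S hb.1) (he.finite hb), h1]

/-- The energy at which a particle of weight `p` enters position `m + 1` of `b`. -/
noncomputable def level (p : ℕ) (b e : Config) (m : ℤ) : ℤ := (m + 1) * p - prefixSum (flux b e) m

theorem level_succ (hb : b ∈ C k) (he : IsCarry k q b e) (m : ℤ) :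
    level p b e (m + 1) + S b m + e m = level p b e m + p := by
  rw [level, level, prefixSum_succ (finite_flux hb he), flux]
  push_cast
  ring

theorem level_mono (hb : b ∈ CMax k p) (hp : p ≤ k) (he : IsCarry k (k - p) b e) :
    Monotone (level p b e) := by
  refine monotone_int_of_le_succ fun m => ?_
  have h1 := level_succ (p := p) hb.1 he m
  have h2 := he.S_add_le hp hb.2.1 hb.2.2 m
  omega

theorem IsTop.eq {g : ℤ} (hh : IsTop k p a h) (hg : IsTop k p a g) : h = g := by
  rw [← hh.highest_eq, hg.highest_eq]

/-- The sum clause feeds `sum_A_iota`; the agreement to the left of the top is used to compare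
levels in `Extract.level_eq`. -/
theorem Extract.exists_carry (hx : Extract k p a b s) (hq : p + q ≤ k) (he : IsCarry k q a e) :
    ∃ e', IsCarry k q b e' ∧ ∑ᶠ j, e j = ∑ᶠ j, e' j + (p - q) ∧
      ∀ h, IsTop k p a h → ∀ j, j < h → e' j = e j := by
  induction hx generalizing e with
  | free ha hh hf =>
    obtain ⟨e', h1, h2, h3⟩ := hf.exists_carry ha.mem hq he
    refine ⟨e', h1, h3, fun g hg j hj => h2 j ?_⟩
    rw [hh.eq hg]
    omega
  | move ha hx ih =>
    obtain ⟨h, hh⟩ := ha.top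
    obtain ⟨g, hg⟩ := ha.rightMove.top
    have hm := hh.isMove ha.mem
    have hle := (hm.top_le hh hg).1
    obtain ⟨e₁, h1, h2, h3⟩ := hm.exists_carry ha.mem hh hq he
    obtain ⟨e', h4, h5, h6⟩ := ih h1
    refine ⟨e', h4, by rw [← h3, h5], fun h' hh' j hj => ?_⟩
    rw [hh'.eq hh] at hj
    rw [h6 g hg j (by omega), h2 j (by omega)]

theorem extract_induction {P : Config → Prop} (zero : P 0)
    (step : ∀ p a b s, Extract k p a b s → P b → P a) : ∀ a ∈ C k, P a := by
  have key : ∀ n, ∀ a ∈ C k, length a ≤ n → P a := by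
    intro n
    induction n with
    | zero =>
      intro a ha h0
      rw [length_eq_zero ha (by omega)]
      exact zero
    | succ n ih =>
      intro a ha hn
      by_cases hne : a = 0
      · rw [hne]; exact zero
      obtain ⟨b, s, he⟩ := (hasWeight_weight ha hne).exists_extract
      have h1 := he.length_eq
      have h2 := he.hasWeight.pos
      exact step _ _ _ _ he (ih b he.mem_CMax.1 (by omega))
  exact fun a ha => key _ a ha le_rfl

/-- Extracting p' ≤ p lowers the length by p' and the total carry by (p + p' - k)_+, which together
account for A_{p,p'} = 2p' + (p + p' - k)_+. -/
theorem sum_A_iota (hp : p ≤ k) : ∀ a ∈ C k, a ∈ CMax k p → ∀ e, IsCarry k (k - p) a e →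
    ((iota k a).map fun r => (A k p r.1 : ℤ)).sum = 2 * length a + ∑ᶠ j, e j := by
  refine extract_induction (fun _ e he => ?_) fun p' a b s hx ih ha e he => ?_
  · have h0 : IsCarry k (k - p) 0 0 := ⟨fun m => by simp [S], 0, fun _ _ => rfl⟩
    rw [iota_zero, he.unique h0, length]
    simp
  · have hle : p' ≤ p := by
      rw [← hx.hasWeight.weight_eq]
      exact weight_le ha
    have hb : b ∈ CMax k p := by
      have := hx.mem_CMax
      exact ⟨this.1, fun i => (this.2.1 i).trans hle, fun i => (this.2.2 i).trans (by omega)⟩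
    obtain ⟨e', h1, h2, -⟩ := hx.exists_carry (q := k - p) (by omega) he
    rw [hx.iota_eq, List.map_cons, List.sum_cons, ih hb e' h1, hx.length_eq, h2, A]
    rw [min_eq_right hle]
    push_cast
    omega

/-- Backwards from the free configuration, where the particle is an insertion to the right of
everything else and there is no carry from h on. -/
theorem Extract.exists_isInsert (hx : Extract k p a b s) (he : IsCarry k (k - p) b e)
    (hh : IsTop k p a h) :
    ∃ x, 0 < x ∧ IsInsert k p b e h x a ∧ s = level p b e h - x + ∑ᶠ j, flux b e j := by
  have hpk := hx.hasWeight.le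
  induction hx generalizing h with
  | @free a g ha hg hf =>
    obtain rfl := hh.eq hg
    have hb := cutLeft_mem_CMax (h := h) ha.mem
    have hge : ∀ j, h ≤ j → cutLeft h a j = 0 := fun j hj => cutLeft_ge hj
    have ez := he.eq_zero_right hb.1.2 hge
    have c1 := cutLeft_lt (a := a) (show h - 1 < h by omega)
    have c2 := cutLeft_lt (a := a) (show h - 2 < h by omega)
    have c3 := cutLeft_lt (a := a) (show h - 3 < h by omega)
    have c0 := hge h le_rfl
    have z1 := ez (h + 1) (by omega)
    have hS := hf.S_eq
    have t1 := ha.mem.1.2 (h - 1)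
    have b1 := ha.mem.2.2 (h - 1)
    have b2 := ha.mem.2.2 (h - 2)
    have b3 := ha.mem.2.1 (h - 1)
    have e0 := he.eq h
    have e1 := he.eq (h - 1)
    have z0 : e h = 0 := by
      clear e1 b2
      simp only [S, L, sub_eq_add_neg, add_assoc, Int.reduceNeg, Int.reduceAdd, Int.add_zero] at *
      omega
    have ez' : ∀ j, h ≤ j → e j = 0 := fun j hj => by
      rcases eq_or_lt_of_le hj with rfl | hj
      · exact z0
      · exact ez j hj
    refine ⟨a h, Nat.pos_of_ne_zero hf.ne, ⟨?_, fun j hj => (cutLeft_lt hj).symm, by omega,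
      by rw [hS, z0, add_zero], fun j hj => ?_⟩, ?_⟩
    · simp only [S, L, sub_eq_add_neg, add_assoc, Int.reduceNeg, Int.reduceAdd, Int.add_zero] at *
      omega
    · rw [hf.zero j (by omega), ez' _ (by omega), ez' _ (by omega), hge _ (by omega)]
    · rw [level, prefixSum_eq_finsum, pairEnergy]
      · rw [S] at hS
        rw [← hS]
        push_cast
        ring
      · intro j hj
        rw [flux, S, hge _ hj, hge _ (by omega), ez' _ hj]
  | move ha hx ih =>
    obtain ⟨g, hg⟩ := ha.rightMove.top
    obtain ⟨y, hy, hi, hs⟩ := ih he hg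
    obtain ⟨x, h1, h2, h3⟩ := (hh.isMove ha.mem).isInsert hpk he ha.mem hx.mem_CMax hh hg hy hi
      (level p _ e) (level_succ hx.mem_CMax.1 he)
    exact ⟨x, h1, h2, by omega⟩

/-- The total flux in s cancels against the sum of the A_{p,λ_j}. -/
theorem Extract.iota_eq_level (hx : Extract k p a b s) (he : IsCarry k (k - p) b e)
    (hh : IsTop k p a h) :
    ∃ x, 0 < x ∧ IsInsert k p b e h x a ∧ iota k a = (p, level p b e h - x) :: iota k b := by
  obtain ⟨x, h1, h2, h3⟩ := hx.exists_isInsert he hh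
  refine ⟨x, h1, h2, ?_⟩
  rw [hx.iota_eq, sum_A_iota hx.hasWeight.le b hx.mem_CMax.1 hx.mem_CMax e he, h3,
    finsum_flux hx.mem_CMax.1 he]
  push_cast
  rw [add_sub_cancel_right]

/-- Forward direction: an insertion beyond all tight places of b is undone by the right moves, which
return b itself. -/
theorem IsInsert.extract (hb : b ∈ CMax k p) (hp : 0 < p) (hpk : p ≤ k)
    (he : IsCarry k (k - p) b e) (hi : IsInsert k p b e h x a)
    (hlt : ∀ j, h ≤ j → S b j < p ∧ L b j < k + p) :
    Extract k p a b (level p b e h - x + ∑ᶠ j, flux b e j) := by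
  obtain ⟨M, N, -, -, hN⟩ := exists_bounds hb.1.1
  have ez := he.eq_zero_right hb.1.2 hN
  have hweight : ∀ {h : ℤ} {x : ℕ} {a : Config}, 0 < x → IsInsert k p b e h x a →
      (∀ j, h ≤ j → S b j < p ∧ L b j < k + p) → HasWeight k p a ∧ IsTop k p a h := by
    intro h x a hx hi hlt
    have hmem := hi.mem_CMax he hpk hb
    have htop : IsTop k p a h := ⟨hi.tight he hpk hx, fun j hj => by
      have := hi.not_tight he hpk hb hx hlt j hj
      omega⟩
    exact ⟨⟨hp, hpk, hmem, h, htop⟩, htop⟩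
  have hfree : ∀ {h : ℤ} {x : ℕ} {a : Config}, N < h → 0 < x → IsInsert k p b e h x a →
      (∀ j, h ≤ j → S b j < p ∧ L b j < k + p) →
      Extract k p a b (level p b e h - x + ∑ᶠ j, flux b e j) := by
    intro h x a hh hx hi hlt
    obtain ⟨hw, ht⟩ := hweight hx hi hlt
    have hs := hi.S_self
    have hself := hi.self
    rw [ez h hh, add_zero] at hs
    rw [hN h (by omega), zero_add] at hself
    have hf : IsFreeAt p a h := ⟨hs, by omega, fun j hj => by
      have := hi.gt j (by omega)
      rw [hN _ (by omega), ez (j - 1) (by omega), ez (j - 2) (by omega)] at this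
      omega⟩
    have hcut : cutLeft h a = b := by
      funext j
      simp only [cutLeft]
      split_ifs with hj
      · exact hi.lt j hj
      · exact (hN j (by omega)).symm
    have := Extract.free hw ht hf
    rw [hcut] at this
    convert this using 1
    rw [level, prefixSum_eq_finsum, pairEnergy]
    · rw [S] at hs
      rw [← hs, hself]
      push_cast
      ring
    · intro j hj
      rw [flux, S, hN _ (by omega), hN _ (by omega), ez _ (by omega)]
  -- Excess zero at h is the same configuration as the largest possible excess at h + 1.
  have hshift : ∀ {h : ℤ} {a : Config}, IsInsert k p b e h 0 a →
      ∃ y, y + S b h + e h = p ∧ IsInsert k p b e (h + 1) y a := by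
    intro h a hi
    have hd := he.S_add_le hpk hb.2.1 hb.2.2 h
    refine ⟨p - (S b h + e h), by omega, ?_, fun j hj => ?_, ?_, ?_, fun j hj => ?_⟩
    · rw [add_sub_cancel_right]
      omega
    · rcases eq_or_lt_of_le (show j ≤ h by omega) with rfl | hj
      · rw [hi.self, add_zero]
      · exact hi.lt j hj
    · have h1 := hi.apply_succ
      simp only [S] at *
      omega
    · have := hi.S_succ
      omega
    · exact hi.gt j (by omega)
  -- Lexicographic induction on the distance to the end of the support, then on the excess.
  have key : ∀ n : ℕ, ∀ (h : ℤ) (x : ℕ) (a : Config), N + 1 - h ≤ n → IsInsert k p b e h x a →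
      (∀ j, h ≤ j → S b j < p ∧ L b j < k + p) →
      Extract k p a b (level p b e h - x + ∑ᶠ j, flux b e j) := by
    intro n
    induction n with
    | zero =>
      intro h x a hn hi hlt
      push_cast at hn
      rcases Nat.eq_zero_or_pos x with rfl | hx
      · obtain ⟨y, hy, hi'⟩ := hshift hi
        have hl := level_succ (p := p) hb.1 he h
        have v1 : S b h = 0 := by rw [S, hN _ (by omega), hN _ (by omega)]
        have v2 := ez h (by omega)
        convert hfree (by omega) (by omega) hi' (fun j hj => hlt j (by omega)) using 2
        push_cast
        omega
      · exact hfree (by omega) hx hi hlt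
    | succ n ih =>
      intro h x
      induction x with
      | zero =>
        intro a hn hi hlt
        obtain ⟨y, hy, hi'⟩ := hshift hi
        have hl := level_succ (p := p) hb.1 he h
        push_cast at hn
        convert ih (h + 1) y a (by omega) hi' (fun j hj => hlt j (by omega)) using 2
        push_cast
        omega
      | succ x ihx =>
        intro a hn hi hlt
        obtain ⟨hw, ht⟩ := hweight (by omega) hi hlt
        have hm := ht.isMove hw.mem
        have hi' : IsInsert k p b e h x (rightMove k p a) := by
          refine ⟨?_, fun j hj => ?_, ?_, ?_, fun j hj => ?_⟩
          · have := hi.le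
            omega
          · rw [hm.of_ne j (by omega) (by omega), hi.lt j hj]
          · have h1 := hm.self
            have h2 := hi.self
            omega
          · rw [hm.S_self, hi.S_self]
          · rw [hm.of_ne j (by omega) (by omega), hi.gt j hj]
        convert Extract.move hw (ihx _ hn hi' hlt) using 1
        push_cast
        ring
  exact key (N + 1 - h).toNat h x a (by omega) hi hlt

/-- The right side is the rigging of the particle at h in b, so that rigging can be read off from
the levels of b. Left of h - 1 the fluxes of b and b₂ agree, and at h - 1 they differ by x. -/
theorem Extract.level_eq {b₂ e₂ : Config} (hx : Extract k p b b₂ s) (he : IsCarry k (k - p) b e)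
    (he₂ : IsCarry k (k - p) b₂ e₂) (hi : IsInsert k p b₂ e₂ h x b) (hh : IsTop k p b h) :
    level p b e h = level p b₂ e₂ h - x := by
  have hpk := hx.hasWeight.le
  obtain ⟨e', h1, -, h3⟩ := hx.exists_carry (q := k - p) (by omega) he
  obtain rfl := h1.unique he₂
  have hfin : {i : ℤ | (fun j => if j < h then flux b₂ e' j else 0) i ≠ 0}.Finite :=
    (finite_flux hx.mem_CMax.1 he₂).subset fun i hi => by
      simp only [Set.mem_ofPred_eq] at *
      intro h0
      rw [h0] at hi
      simp at hi
  have : prefixSum (flux b e) h = prefixSum (flux b₂ e') h + x := by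
    rw [prefixSum, prefixSum, ← finsum_add_ite hfin (h - 1)]
    refine finsum_congr fun j => ?_
    rcases lt_trichotomy j (h - 1) with hj | rfl | hj
    · rw [if_pos (by omega), if_pos (by omega), if_neg (by omega), add_zero, flux, flux,
        hi.S_lt hj, h3 h hh j (by omega)]
    · rw [if_pos (by omega), if_pos (by omega), if_pos rfl, flux, flux, hi.S_pred,
        h3 h hh (h - 1) (by omega)]
      ring
    · rw [if_neg (by omega), if_neg (by omega), if_neg (by omega)]
  rw [level, level, this]
  push_cast
  ring

/-! ### The image of `iota`: ordering of riggings and surjectivity. -/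

theorem CMax_mono {l : ℕ} (hl : p ≤ l) (ha : a ∈ CMax k p) : a ∈ CMax k l :=
  ⟨ha.1, fun i => (ha.2.1 i).trans hl, fun i => (ha.2.2 i).trans (by omega)⟩

theorem Extract.weight_le (hx : Extract k p a b s) : weight k b ≤ p :=
  RiggedConf.weight_le hx.mem_CMax

theorem iota_mem_R : ∀ a ∈ C k, iota k a ∈ R (weight k a) := by
  refine extract_induction ?_ fun p a b s hx ih => ?_
  · rw [iota_zero]
    exact ⟨by simp, by simp⟩
  have ha := hx.hasWeight
  have hb := hx.mem_CMax
  obtain ⟨e, he⟩ := exists_isCarry k (k - p) hb.1.1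
  obtain ⟨h, hh⟩ := ha.top
  obtain ⟨x, hx0, hi, hio⟩ := hx.iota_eq_level he hh
  rw [hio, ha.weight_eq]
  refine ⟨fun r hr => ?_, List.isChain_cons.2 ⟨fun y hy => ?_, ih.2⟩⟩
  · rcases List.mem_cons.1 hr with rfl | hr
    · exact ⟨ha.pos, le_rfl⟩
    · exact ⟨(ih.1 r hr).1, (ih.1 r hr).2.trans hx.weight_le⟩
  · have hmem := ih.1 y (List.mem_of_mem_head? hy)
    refine ⟨hmem.2.trans hx.weight_le, fun hpy => ?_⟩
    have hb0 : b ≠ 0 := by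
      rintro rfl
      rw [iota_zero] at hy
      simp at hy
    have hwb := hasWeight_weight hb.1 hb0
    rw [show weight k b = p by
      have := hx.weight_le
      simp only at hpy
      omega] at hwb
    obtain ⟨b₂, s₂, hx₂⟩ := hwb.exists_extract
    obtain ⟨e₂, he₂⟩ := exists_isCarry k (k - p) hx₂.mem_CMax.1.1
    obtain ⟨g, hg⟩ := hwb.top
    obtain ⟨x₂, -, hi₂, hio₂⟩ := hx₂.iota_eq_level he₂ hg
    rw [hio₂] at hy
    simp only [List.head?_cons, Option.mem_def, Option.some.injEq] at hy
    subst hy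
    simp only
    rw [← hx₂.level_eq he he₂ hi₂ hg]
    -- As g ≤ h - 1, the second rigging level(g) is at most level(h-1), and level(h-1) ≤ level(h) -
    -- x because x fits at h.
    have hgh : g < h := by
      by_contra hle
      obtain ⟨i, hi1, hi2⟩ := hi.exists_tight he ha.le hb (by omega) hg.tight
        (fun j hj => hg.lt hb j hj)
      exact hh.not_tight i hi1 hi2
    have h1 := level_mono hb ha.le he (show g ≤ h - 1 by omega)
    have h2 := level_succ (p := p) hb.1 he (h - 1)
    rw [sub_add_cancel] at h2
    have h3 := hi.le
    omega

/-- Levels are unbounded both ways: (z+1)p minus the finite total flux is a lower bound for the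
level at z, and (z+1)p an upper bound, with p ≥ 1. -/
theorem exists_level {ρ : ℤ} (hb : b ∈ CMax k p) (hp : 0 < p)
    (he : IsCarry k q b e) :
    ∃ h, ρ < level p b e h ∧ level p b e (h - 1) ≤ ρ := by
  obtain ⟨h, h1, h2⟩ := Int.exists_least_of_bdd (P := fun h => ρ < level p b e h)
    ⟨-|ρ| - 1, fun z hz => by
      by_contra hlt
      have h1 : level p b e z ≤ (z + 1) * p := by
        rw [level]
        omega
      have h2 : (z + 1) * (p : ℤ) ≤ (z + 1) * 1 :=
        mul_le_mul_of_nonpos_left (by omega) (by have := abs_nonneg ρ; omega)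
      have h3 := neg_abs_le ρ
      omega⟩
    ⟨|ρ| + ∑ᶠ j, flux b e j, by
      have h1 := prefixSum_le_finsum (finite_flux hb.1 he) (|ρ| + ∑ᶠ j, flux b e j)
      have h2 : (|ρ| + ∑ᶠ j, flux b e j + 1) * 1 ≤ (|ρ| + ∑ᶠ j, flux b e j + 1) * (p : ℤ) :=
        mul_le_mul_of_nonneg_left (by omega) (by positivity)
      have h3 := le_abs_self ρ
      rw [level]
      omega⟩
  refine ⟨h, h1, ?_⟩
  by_contra hlt
  have := h2 (h - 1) (by omega)
  omega

theorem exists_iota_eq {l : ℕ} (hl : l ≤ k) (y : List (ℕ × ℤ)) (hy : y ∈ R l) :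
    ∃ a ∈ CMax k l, iota k a = y := by
  induction y generalizing l with
  | nil =>
    refine ⟨0, ⟨⟨by simp, fun i => by simp⟩, fun i => by simp [S], fun i => by simp [L]⟩,
      iota_zero k⟩
  | cons r y ih =>
    obtain ⟨p, ρ⟩ := r
    have hp := hy.1 (p, ρ) (by simp)
    simp only at hp
    have : IsTrans (ℕ × ℤ) fun p q => q.1 ≤ p.1 ∧ (p.1 = q.1 → q.2 ≤ p.2) :=
      ⟨fun u v w h1 h2 => ⟨h2.1.trans h1.1, fun h3 =>
        (h2.2 (by have := h2.1; have := h1.1; omega)).trans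
          (h1.2 (by have := h2.1; have := h1.1; omega))⟩⟩
    have hpw := List.isChain_iff_pairwise.1 hy.2
    have hyR : y ∈ R p := ⟨fun r hr => ⟨(hy.1 r (by simp [hr])).1,
      ((List.pairwise_cons.1 hpw).1 r hr).1⟩, (List.isChain_cons.1 hy.2).2⟩
    have hpk : p ≤ k := hp.2.trans hl
    obtain ⟨b, hb, rfl⟩ := ih hpk hyR
    obtain ⟨e, he⟩ := exists_isCarry k (k - p) hb.1.1
    obtain ⟨h, h1, h2⟩ := exists_level (ρ := ρ) hb hp.1 he
    have h3 := level_succ (p := p) hb.1 he (h - 1)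
    rw [sub_add_cancel] at h3
    -- A tight place of b at or beyond h would make its first part p with rigging level(g) for some
    -- g ≥ h, whence ρ ≥ level(g) ≥ level(h) > ρ.
    have hlt : ∀ j, h ≤ j → S b j < p ∧ L b j < k + p := by
      intro j hj
      by_contra hcon
      have htj : S b j = p ∨ L b j = k + p := by
        have := hb.2.1 j
        have := hb.2.2 j
        omega
      obtain ⟨g, hg, hjg⟩ := exists_isTop hp.1 hb.1 htj
      have hwb : HasWeight k p b := ⟨hp.1, hpk, hb, g, hg⟩
      obtain ⟨b₂, s₂, hx₂⟩ := hwb.exists_extract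
      obtain ⟨e₂, he₂⟩ := exists_isCarry k (k - p) hx₂.mem_CMax.1.1
      obtain ⟨x₂, -, hi₂, hio₂⟩ := hx₂.iota_eq_level he₂ hg
      have hle := ((List.pairwise_cons.1 hpw).1 (p, level p b₂ e₂ g - x₂)
        (by rw [hio₂]; exact List.mem_cons_self)).2 rfl
      simp only at hle
      rw [← hx₂.level_eq he he₂ hi₂ hg] at hle
      have := level_mono hb hpk he (show h ≤ g by omega)
      omega
    -- The excess level(h) - ρ fits at h exactly because level(h-1) ≤ ρ.
    have hi := isInsert_insertAt (p := p) (h := h) (x := (level p b e h - ρ).toNat) he hb.1.2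
      (by omega)
    have hx := hi.extract hb hp.1 hpk he hlt
    refine ⟨_, CMax_mono hp.2 hx.hasWeight.mem, ?_⟩
    rw [hx.iota_eq, sum_A_iota hpk b hb.1 hb e he, finsum_flux hb.1 he]
    congr 2
    push_cast
    omega

/-! ### The first two entries as maxima over the riggings. -/

/-- The riggings of `y` bound, and determine, the first two entries `u`, `v` of a configuration
supported on `[m, ∞)`. -/
structure Bounds (m : ℤ) (y : List (ℕ × ℤ)) (u v : ℕ) : Prop where
  nonneg : ∀ r ∈ y, m * r.1 ≤ r.2
  first_le : ∀ r ∈ y, (m + 1) * r.1 - r.2 ≤ u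
  second_le : ∀ r ∈ y, (m + 2) * r.1 - r.2 ≤ 2 * u + v
  first : u = 0 ∨ ∃ r ∈ y, (m + 1) * r.1 - r.2 = u
  second : 2 * u + v = 0 ∨ ∃ r ∈ y, (m + 2) * r.1 - r.2 = 2 * u + v

theorem Bounds.cons {m : ℤ} {y : List (ℕ × ℤ)} {u v u' v' : ℕ} (hy : Bounds m y u v)
    {r : ℕ × ℤ} (h0 : m * r.1 ≤ r.2) (hu : (u' : ℤ) = max (u : ℤ) ((m + 1) * r.1 - r.2))
    (hv : 2 * (u' : ℤ) + v' = max (2 * (u : ℤ) + v) ((m + 2) * r.1 - r.2)) :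
    Bounds m (r :: y) u' v' := by
  refine ⟨?_, ?_, ?_, ?_, ?_⟩
  · rintro w hw
    rcases List.mem_cons.1 hw with rfl | hw
    exacts [h0, hy.nonneg w hw]
  · rintro w hw
    rcases List.mem_cons.1 hw with rfl | hw
    · omega
    · have := hy.first_le w hw
      omega
  · rintro w hw
    rcases List.mem_cons.1 hw with rfl | hw
    · omega
    · have := hy.second_le w hw
      omega
  · rcases le_total ((m + 1) * (r.1 : ℤ) - r.2) u with h1 | h1
    · rw [max_eq_left h1] at hu
      rcases hy.first with h2 | ⟨w, hw, h2⟩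
      · left; omega
      · exact Or.inr ⟨w, List.mem_cons_of_mem _ hw, by omega⟩
    · exact Or.inr ⟨r, List.mem_cons_self, by omega⟩
  · rcases le_total ((m + 2) * (r.1 : ℤ) - r.2) (2 * u + v) with h1 | h1
    · rw [max_eq_left h1] at hv
      rcases hy.second with h2 | ⟨w, hw, h2⟩
      · left; omega
      · exact Or.inr ⟨w, List.mem_cons_of_mem _ hw, by omega⟩
    · exact Or.inr ⟨r, List.mem_cons_self, by omega⟩

/-- Inserting the heaviest particle updates both maxima by one term: both may grow if it sits at m,
only the second if it sits at m + 1, and neither if it sits further right. -/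
theorem iota_bounds : ∀ a ∈ C k, ∀ m, (∀ i, i < m → a i = 0) →
    Bounds m (iota k a) (a m) (a (m + 1)) := by
  refine extract_induction (fun m _ => ?_) fun p a b s hx ih m hm => ?_
  · rw [iota_zero]
    exact ⟨by simp, by simp, by simp, by simp, by simp⟩
  have ha := hx.hasWeight
  have hb := hx.mem_CMax
  obtain ⟨e, he⟩ := exists_isCarry k (k - p) hb.1.1
  obtain ⟨h, hh⟩ := ha.top
  obtain ⟨x, hx0, hi, hio⟩ := hx.iota_eq_level he hh
  have hmh : m ≤ h := by
    by_contra hlt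
    have h1 := hm h (by omega)
    have h2 := hi.self
    omega
  have hbm : ∀ i, i < m → b i = 0 := fun i hi' => by
    rw [← hi.lt i (by omega), hm i hi']
  have hez := he.eq_zero_left hb.1.2 hbm
  have l0 : level p b e m = m * p + p - b m := by
    have h1 := level_succ (p := p) hb.1 he (m - 1)
    have h2 : level p b e (m - 1) = m * p := by
      rw [level, prefixSum_eq_zero, sub_add_cancel]
      · simp
      · intro j hj
        rw [flux, S, hbm _ (by omega), hbm _ (by omega), hez _ (by omega)]
    rw [sub_add_cancel, h2, S, hbm _ (by omega), sub_add_cancel, hez (m - 1) (by omega)] at h1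
    push_cast at h1
    omega
  have l1 : level p b e (m + 1) = m * p + 2 * p - 2 * b m - b (m + 1) := by
    have h1 := level_succ (p := p) hb.1 he m
    rw [S, hez m le_rfl] at h1
    push_cast at h1
    omega
  have hS := hb.2.1 m
  rw [S] at hS
  have e1 : (m + 1) * (p : ℤ) = m * p + p := by ring
  have e2 : (m + 2) * (p : ℤ) = m * p + 2 * p := by ring
  rw [hio]
  refine (ih m hbm).cons ?_ ?_ ?_
  all_goals simp only [e1, e2]
  all_goals
    -- For h = m the entries become b m + x and p - b m - x; for h = m + 1 the first is kept and the
    -- second grows by x; beyond that, ρ ≥ level(m+1) keeps both new terms below the old maxima.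
    rcases eq_or_lt_of_le hmh with rfl | h1
    · have h2 := hi.self
      have h3 := hi.apply_succ
      have h4 := hez m le_rfl
      omega
    have h2 := hi.lt m h1
    have h6 := hi.le
    rcases eq_or_lt_of_le (show m + 1 ≤ h by omega) with rfl | h4
    · have h5 := hi.self
      rw [add_sub_cancel_right, S] at h6
      omega
    · have h5 := hi.lt (m + 1) h4
      have h7 := level_mono hb ha.le he (show m + 1 ≤ h - 1 by omega)
      have h8 := level_succ (p := p) hb.1 he (h - 1)
      rw [sub_add_cancel] at h8
      omega

/-- At the least m of the support, a_m > 0 must equal some (m+1)λ - ρ, which is not positive if m <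
0 ≤ ρ. -/
theorem support_nonneg (ha : a ∈ C k) (hr : ∀ r ∈ iota k a, 0 ≤ r.2) (i : ℤ) (hi : i < 0) :
    a i = 0 := by
  by_contra hne
  obtain ⟨M, N, -, hM, hN⟩ := exists_bounds ha.1
  obtain ⟨m, h1, h2⟩ := Int.exists_least_of_bdd (P := fun j => a j ≠ 0)
    ⟨M, fun z hz => by
      by_contra hlt
      exact hz (hM z (by omega))⟩ ⟨i, hne⟩
  have hb := iota_bounds a ha m fun j hj => by
    by_contra hj0
    have := h2 j hj0
    omega
  have hmi := h2 i hne
  rcases hb.first with h3 | ⟨r, hr', h3⟩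
  · exact h1 h3
  · have h4 := hr r hr'
    have h5 : (m + 1) * (r.1 : ℤ) ≤ 0 := mul_nonpos_of_nonpos_of_nonneg (by omega) (by positivity)
    omega

/-- Surjectivity provides a preimage in C^(k,l), and its first two entries are forced because
`Bounds` determines u and 2u + v. The right side no longer involves k. -/
theorem image_CInit {l : ℕ} (hl : l ≤ k) (u v : ℕ) :
    iota k '' CInit k l u v = {y | y ∈ R l ∧ Bounds 0 y u v} := by
  ext y
  constructor
  · rintro ⟨a, ⟨⟨ha, hpos⟩, rfl, rfl⟩, rfl⟩
    have h1 := iota_mem_R a ha.1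
    refine ⟨⟨fun r hr => ⟨(h1.1 r hr).1, (h1.1 r hr).2.trans (weight_le ha)⟩, h1.2⟩, ?_⟩
    simpa using iota_bounds a ha.1 0 hpos
  · rintro ⟨hy, hb⟩
    obtain ⟨a, ha, rfl⟩ := exists_iota_eq hl y hy
    have hpos := support_nonneg ha.1 fun r hr => by simpa using hb.nonneg r hr
    have hb' := iota_bounds a ha.1 0 hpos
    have h1 : a 0 = u := by
      refine le_antisymm ?_ ?_
      · rcases hb'.first with h | ⟨r, hr, h⟩
        · omega
        · have := hb.first_le r hr
          omega
      · rcases hb.first with h | ⟨r, hr, h⟩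
        · omega
        · have := hb'.first_le r hr
          omega
    have h2 : 2 * a 0 + a 1 = 2 * u + v := by
      refine le_antisymm ?_ ?_
      · rcases hb'.second with h | ⟨r, hr, h⟩
        · rw [zero_add] at h
          omega
        · have := hb.second_le r hr
          rw [zero_add 1] at h
          omega
      · rcases hb.second with h | ⟨r, hr, h⟩
        · omega
        · have := hb'.second_le r hr
          rw [zero_add 1] at this
          omega
    exact ⟨a, ⟨⟨ha, hpos⟩, h1, by omega⟩, rfl⟩

/-! ### Translation into bounds on riggings and removed subsets. -/

/-- The three pieces of r_{u,v} are those of the convex function max(0, i - u, 2i - 2u - v). -/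
theorem rInit_le_iff {u v i : ℕ} {ρ : ℤ} :
    (rInit u v i : ℤ) ≤ ρ ↔ 0 ≤ ρ ∧ (i : ℤ) - ρ ≤ u ∧ 2 * (i : ℤ) - ρ ≤ 2 * u + v := by
  simp only [rInit]
  split_ifs <;> omega

theorem mem_RBound_iff {l u v : ℕ} {y : List (ℕ × ℤ)} :
    y ∈ RBound l (rInit u v) ↔ y ∈ R l ∧ ∀ r ∈ y,
      0 ≤ r.2 ∧ (r.1 : ℤ) - r.2 ≤ u ∧ 2 * (r.1 : ℤ) - r.2 ≤ 2 * u + v := by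
  simp only [RBound, Set.mem_ofPred_eq, rInit_le_iff]

theorem bounds_zero_iff {u v : ℕ} {y : List (ℕ × ℤ)} :
    Bounds 0 y u v ↔ (∀ r ∈ y, 0 ≤ r.2 ∧ (r.1 : ℤ) - r.2 ≤ u ∧ 2 * (r.1 : ℤ) - r.2 ≤ 2 * u + v) ∧
      (u = 0 ∨ ∃ r ∈ y, (r.1 : ℤ) - r.2 = u) ∧
      (2 * u + v = 0 ∨ ∃ r ∈ y, 2 * (r.1 : ℤ) - r.2 = 2 * u + v) := by
  constructor
  · rintro ⟨h0, h1, h2, h3, h4⟩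
    simp only [zero_mul, zero_add, one_mul] at *
    exact ⟨fun r hr => ⟨h0 r hr, h1 r hr, h2 r hr⟩, h3, h4⟩
  · rintro ⟨h0, h3, h4⟩
    refine ⟨fun r hr => ?_, fun r hr => ?_, fun r hr => ?_, ?_, ?_⟩ <;>
      simp only [zero_mul, zero_add, one_mul]
    exacts [(h0 r hr).1, (h0 r hr).2.1, (h0 r hr).2.2, h3, h4]

theorem notMem_RBound_bump {l : ℕ} {r : ℕ → ℕ} {y : List (ℕ × ℤ)} (hy : y ∈ RBound l r)
    (J : Finset ℕ) :
    y ∉ RBound l (bump r J) ↔ ∃ w ∈ y, w.1 ∈ J ∧ w.2 = r w.1 := by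
  constructor
  · intro hn
    by_contra hcon
    push Not at hcon
    refine hn ⟨hy.1, fun w hw => ?_⟩
    have h1 := hy.2 w hw
    have h2 := hcon w hw
    simp only [bump]
    split_ifs with hJ
    · have := h2 hJ
      push_cast
      omega
    · exact h1
  · rintro ⟨w, hw, hJ, hwr⟩ hn
    have := hn.2 w hw
    simp only [bump, if_pos hJ] at this
    push_cast at this
    omega

/-- The interval is where i - u attains the maximum defining r_{u,v}(i); in `rInit_eq_iff_second` it
is where 2i - 2u - v does, cut off at l. -/
theorem rInit_eq_iff_first {u v i : ℕ} {ρ : ℤ} (hρ : 0 ≤ ρ)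
    (h2 : 2 * (i : ℤ) - ρ ≤ 2 * u + v) :
    (i ∈ Finset.Icc u (u + v) ∧ ρ = rInit u v i) ↔ (i : ℤ) - ρ = u := by
  simp only [rInit, Finset.mem_Icc]
  split_ifs <;> omega

theorem rInit_eq_iff_second {l u v i : ℕ} {ρ : ℤ} (hi : i ≤ l) (hρ : 0 ≤ ρ)
    (h1 : (i : ℤ) - ρ ≤ u) :
    (i ∈ Finset.Icc (u + v) l ∧ ρ = rInit u v i) ↔ 2 * (i : ℤ) - ρ = 2 * u + v := by
  simp only [rInit, Finset.mem_Icc]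
  split_ifs <;> omega

theorem mem_RMinus_iff {l u v : ℕ} {Js : List (Finset ℕ)} {y : List (ℕ × ℤ)} :
    y ∈ RMinus l (rInit u v) Js ↔ y ∈ RBound l (rInit u v) ∧
      ∀ J ∈ Js, ∃ w ∈ y, w.1 ∈ J ∧ w.2 = rInit u v w.1 := by
  simp only [RMinus, Set.mem_sdiff, Set.mem_iUnion, not_exists]
  refine and_congr_right fun hy => forall₂_congr fun J _ => ?_
  exact notMem_RBound_bump hy J

end RiggedConf

theorem mainTheorem6 (l a b : ℕ) (hab : a + b ≤ l) :
    (∀ k k' : ℕ, l ≤ k → l ≤ k' →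
      RiggedConf.iota k '' RiggedConf.CInit k l a b =
        RiggedConf.iota k' '' RiggedConf.CInit k' l a b) ∧
    ∀ k : ℕ, l ≤ k →
      (a ≠ 0 →
        RiggedConf.iota k '' RiggedConf.CInit k l a b =
          RiggedConf.RMinus l (RiggedConf.rInit a b)
            [Finset.Icc a (a + b), Finset.Icc (a + b) l]) ∧
      (a = 0 → b ≠ 0 →
        RiggedConf.iota k '' RiggedConf.CInit k l a b =
          RiggedConf.RMinus l (RiggedConf.rInit a b) [Finset.Icc b l]) ∧
      (a = 0 → b = 0 →
        RiggedConf.iota k '' RiggedConf.CInit k l a b =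
          RiggedConf.RBound l (RiggedConf.rInit a b)) := by
  open RiggedConf in
  refine ⟨fun k k' hk hk' => by rw [image_CInit hk, image_CInit hk'], fun k hk => ?_⟩
  rw [image_CInit hk]
  have first : ∀ y ∈ RBound l (rInit a b),
      ((∃ w ∈ y, w.1 ∈ Finset.Icc a (a + b) ∧ w.2 = rInit a b w.1) ↔
        ∃ w ∈ y, (w.1 : ℤ) - w.2 = a) := fun y hy => by
    refine exists_congr fun w => and_congr_right fun hw => ?_
    have := (mem_RBound_iff.1 hy).2 w hw
    exact rInit_eq_iff_first this.1 this.2.2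
  have second : ∀ y ∈ RBound l (rInit a b),
      ((∃ w ∈ y, w.1 ∈ Finset.Icc (a + b) l ∧ w.2 = rInit a b w.1) ↔
        ∃ w ∈ y, 2 * (w.1 : ℤ) - w.2 = 2 * a + b) := fun y hy => by
    refine exists_congr fun w => and_congr_right fun hw => ?_
    have := (mem_RBound_iff.1 hy).2 w hw
    exact rInit_eq_iff_second ((mem_RBound_iff.1 hy).1.1 w hw).2 this.1 this.2.1
  refine ⟨fun ha => ?_, fun ha hb => ?_, fun ha hb => ?_⟩
  · ext y
    rw [mem_RMinus_iff, Set.mem_ofPred_eq, bounds_zero_iff, ← and_assoc, ← mem_RBound_iff]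
    refine and_congr_right fun hy => ?_
    simp only [List.forall_mem_cons, List.forall_mem_nil, and_true]
    rw [first y hy, second y hy]
    simp [ha]
  -- For a = 0 the attainment condition on the first entry is void, so only one set is removed.
  · subst ha
    ext y
    rw [mem_RMinus_iff, Set.mem_ofPred_eq, bounds_zero_iff, ← and_assoc, ← mem_RBound_iff]
    refine and_congr_right fun hy => ?_
    have h2 := second y hy
    rw [zero_add] at h2
    simp only [List.forall_mem_cons, List.forall_mem_nil, and_true]
    rw [h2]
    simp [hb]
  · subst ha hb
    ext y
    rw [Set.mem_ofPred_eq, bounds_zero_iff, ← and_assoc, ← mem_RBound_iff]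
    simp
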